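/- **Setting.** An instance of the Bandit-with-Monotone-Jumps problem with $n\ge 1$ action intervals consists of: points $0=\overline\alpha_1<\overline\alpha_2<\dots<\overline\alpha_{n+1}=1$, defining the intervals $\mathcal A_i=[\overline\alpha_i,\overline\alpha_{i+1})$ for $i<n$ and $\mathcal A_n=[\overline\alpha_n,\overline\alpha_{n+1}]$; probability distributions $\nu_1,\dots,\nu_n$ supported in $[0,1]$ whose means satisfy $\mu_1<\dots<\mu_n$; and a strictly decreasing affine function $\ell:[0,1]\to[0,1]$. For $\alpha\in[0,1]$ let $h(\alpha)$ be the index $i$ with $\alpha\in\mathcal A_i$, let $u(\alpha)=\ell(\alpha)\mu_{h(\alpha)}$, and let $\mathrm{OPT}=\max_{\alpha\in[0,1]}u(\alpha)$. In each round $t=1,\dots,T$ the learner selects $\alpha_t\in[0,1]$ as a function of the past actions and feedback, and then observes a fresh sample $x_t\sim\nu_{h(\alpha_t)}$. The learner knows $\ell$ and $T$ only. The pseudo-regret is $R_T=T\cdot\mathrm{OPT}-\mathbb E\big[\sum_{t=1}^T u(\alpha_t)\big]$. **Algorithm RJI-OS.** Start with the collection of intervals $\mathcal I_1=\{[0,1]\}$.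 In epoch $j=1,2,\dots$, with $\Delta_j=2^{-j}$ and $N_j=\lceil (8/\Delta_j^2)\log(4T^2)\rceil$: 1. Run $\texttt{Find-Jumps}$ on every interval of $\mathcal I_j$, from left to right, and let $\mathcal T_j$ be the collection of all the returned triplets. On $[\alpha_1,\alpha_2]$ with $\alpha_2-\alpha_1\le 1/T$, $\texttt{Find-Jumps}$ plays $\alpha_2$ for $N_j$ rounds, lets $\widehat\mu_2$ be the empirical mean of the observed feedback, and returns $([\alpha_1,\alpha_2],0,\widehat\mu_2)$. On $[\alpha_1,\alpha_2]$ with $\alpha_2-\alpha_1>1/T$, it plays $\alpha_1$ and then $\alpha_2$ for $N_j$ rounds each, and lets $\widehat\mu_1,\widehat\mu_2$ be the respective empirical means; if $\widehat\mu_2-\widehat\mu_1\ge\Delta_j$, it calls itself on $[\alpha_1,\frac{\alpha_1+\alpha_2}2]$ and then on $[\frac{\alpha_1+\alpha_2}2,\alpha_2]$ and returns all the triplets returned by these two calls; otherwise it returns $([\alpha_1,\alpha_2],\widehat\mu_1,\widehat\mu_2)$. 2. Let $\mathrm{OPT}(j)$ be the maximum of $0$ and of all the values $\ell(\alpha_1)\widehat\mu_1$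 and $\ell(\alpha_2)\widehat\mu_2$ for $([\alpha_1,\alpha_2],\widehat\mu_1,\widehat\mu_2)\in\mathcal T_j$. 3. Form $\mathcal I_{j+1}$ as follows. For each $([\alpha_1,\alpha_2],\widehat\mu_1,\widehat\mu_2)\in\mathcal T_j$ with $\alpha_2-\alpha_1\le 1/T$, include $[\alpha_1,\alpha_2]$ if $\ell(\alpha_2)\widehat\mu_2+\Delta_j/2+1/T\ge\mathrm{OPT}(j)$. For each one with $\alpha_2-\alpha_1>1/T$, include the interval $\{\alpha\in[\alpha_1,\alpha_2]:\ell(\alpha)\widehat\mu_1+2\Delta_j+2/T\ge\mathrm{OPT}(j)\}$ if it is non-empty. The execution is stopped as soon as $T$ rounds have been played. **Theorem.** There is a universal constant $C>0$ such that, for every $n\ge1$, every instance with $n$ action intervals and every $T\ge 2$, the pseudo-regret of RJI-OS over $T$ rounds satisfies $$R_T\le C\,\sqrt{nT}\,\log^2 T .$$ In particular, the bound does not depend on the sizes of the gaps $\mu_{i+1}-\mu_i$. -/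

import Mathlib

noncomputable section

open MeasureTheory Set
open scoped Classical

namespace BwMJ

/-! ### Instances of Bandit with Monotone Jumps -/

/-- An instance with `n` action intervals. Indices are shifted by one: the breakpoints are
`bp 0 < bp 1 < ⋯ < bp n`, and the distributions are `ν 0, …, ν (n - 1)`. The fields `bp_zero` and
`bp_last` force `1 ≤ n`. The reward factor `ell` is the (unique) affine extension to `ℝ` of a
strictly decreasing affine function `[0,1] → [0,1]`. -/
structure Instance (n : ℕ) where
  bp : Fin (n + 1) → ℝ
  bp_strictMono : StrictMono bp
  bp_zero : bp 0 = 0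
  bp_last : bp (Fin.last n) = 1
  ν : Fin n → Measure ℝ
  ν_prob : ∀ i, IsProbabilityMeasure (ν i)
  ν_supp : ∀ i, ∀ᵐ x ∂(ν i), x ∈ Icc (0 : ℝ) 1
  mean_strictMono : StrictMono fun i => ∫ x, x ∂(ν i)
  ell : ℝ →ᵃ[ℝ] ℝ
  ell_mapsTo : MapsTo ell (Icc 0 1) (Icc 0 1)
  ell_strictAnti : StrictAntiOn ell (Icc 0 1)

namespace Instance

variable {n : ℕ} (I : Instance n)

instance (i : Fin n) : IsProbabilityMeasure (I.ν i) := I.ν_prob i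

/-- The action intervals: half-open, except for the last one, which is closed. -/
def actionInterval (i : Fin n) : Set ℝ :=
  if (i : ℕ) + 1 = n then Icc (I.bp i.castSucc) (I.bp i.succ)
  else Ico (I.bp i.castSucc) (I.bp i.succ)

/-- The expected value of the `i`-th distribution. -/
def mean (i : Fin n) : ℝ := ∫ x, x ∂(I.ν i)

/-- The index of the interval containing `α ∈ [0,1]`. The intervals are disjoint, so the sum has
at most one nonzero term. -/
def index [NeZero n] (α : ℝ) : Fin n :=
  ∑ i : Fin n, if α ∈ I.actionInterval i then i else 0

/-- The expected reward of an action. -/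
def u [NeZero n] (α : ℝ) : ℝ := I.ell α * I.mean (I.index α)

/-- The optimal expected reward over the action space. -/
def OPT [NeZero n] : ℝ := sSup (I.u '' Icc 0 1)

end Instance

/-! ### Policies, interaction, pseudo-regret -/

/-- A deterministic policy: from the past (action, feedback) pairs, oldest first, to the next
action. -/
abbrev Policy := List (ℝ × ℝ) → ℝ

namespace Instance

variable {n : ℕ} [NeZero n] (I : Instance n)

/-- The randomness of the environment: independent samples `ω (t, i) ∼ ν i`, for every round `t`
and every interval `i`. In round `t` the environment reveals only `ω (t, i)` for the interval `i`
of the action selected in that round; since the action depends on the samples of earlier rounds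
only, the feedback has, given the past, law `ν i`. -/
def envMeasure : Measure (ℕ × Fin n → ℝ) :=
  Measure.infinitePi fun p : ℕ × Fin n => I.ν p.2

/-- The history after `t` rounds of interaction with policy `π`. -/
def history (π : Policy) (ω : ℕ × Fin n → ℝ) : ℕ → List (ℝ × ℝ)
  | 0 => []
  | t + 1 =>
    history π ω t ++ [(π (history π ω t), ω (t, I.index (π (history π ω t))))]

/-- The action selected by policy `π` in round `t` (rounds are numbered from `0`). -/
def action (π : Policy) (ω : ℕ × Fin n → ℝ) (t : ℕ) : ℝ := π (I.history π ω t)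

/-- The cumulative pseudo-regret of policy `π` over `T` rounds. -/
def regret (T : ℕ) (π : Policy) : ℝ :=
  T * I.OPT - ∫ ω, ∑ t ∈ Finset.range T, I.u (I.action π ω t) ∂I.envMeasure

end Instance

/-! ### Interactive programs -/

/-- A program that interacts with the environment: it returns a value, or plays an action `a` and
continues depending on the observed feedback. -/
inductive Prog (β : Type) : Type
  | ret (b : β) : Prog β
  | play (a : ℝ) (k : ℝ → Prog β) : Prog β

namespace Prog

/-- Sequential composition. -/
def bind {β γ : Type} : Prog β → (β → Prog γ) → Prog γ
  | ret b, f => f b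
  | play a k, f => play a fun x => bind (k x) f

instance : Monad Prog where
  pure := Prog.ret
  bind := Prog.bind

/-- The policy that executes a program, one `play` per round (with the action `0` once the program
has returned). -/
def toPolicy {β : Type} : Prog β → Policy
  | ret _, _ => 0
  | play a _, [] => a
  | play _ k, (_, x) :: H => toPolicy (k x) H

/-- Play the action `a` for `N` rounds and return the sum of the observed feedback. -/
def sampleSum (a : ℝ) : ℕ → Prog ℝ
  | 0 => ret 0
  | N + 1 => play a fun x => do
      let s ← sampleSum a N
      return x + s

/-- Play the action `a` for `N` rounds and return the empirical mean of the observed feedback. -/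
def estimate (a : ℝ) (N : ℕ) : Prog ℝ := do
  let s ← sampleSum a N
  return s / N

end Prog

/-! ### The algorithm RJI-OS -/

/-- A triplet `([α₁, α₂], μ₁, μ₂)` consisting of an interval and the estimates at its
extremes. -/
structure Triplet where
  α₁ : ℝ
  α₂ : ℝ
  μ₁ : ℝ
  μ₂ : ℝ

/-- The number `⌈(8 / Δ²) log (4 T / δ)⌉`, with `δ = 1 / T`, of rounds for which an action is
played to estimate its expected feedback. -/
def numSamples (T : ℕ+) (Δ : ℝ) : ℕ :=
  let δ : ℝ := 1 / (T : ℕ)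
  ⌈8 / Δ ^ 2 * Real.log (4 * (T : ℕ) / δ)⌉₊

theorem floor_half_lt (T : ℕ+) {L : ℝ} (h : ¬ L ≤ 1 / (T : ℕ)) :
    ⌊L / 2 * (T : ℕ)⌋₊ < ⌊L * (T : ℕ)⌋₊ := by
  have hT : (0 : ℝ) < (T : ℕ) := by exact_mod_cast T.pos
  rw [not_le, div_lt_iff₀ hT] at h
  have h1 : (1 : ℕ) ≤ ⌊L * (T : ℕ)⌋₊ := Nat.le_floor (by exact_mod_cast h.le)
  have h1' : (1 : ℝ) ≤ (⌊L * (T : ℕ)⌋₊ : ℝ) := by exact_mod_cast h1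
  rw [Nat.floor_lt (by nlinarith)]
  have h2 := Nat.lt_floor_add_one (L * (T : ℕ))
  linarith

/-- `Find-Jumps` on the interval `[α₁, α₂]` with gap `Δ`. The recursion ends because the lengths
of the intervals are halved. -/
def findJumps (T : ℕ+) (Δ α₁ α₂ : ℝ) : Prog (List Triplet) :=
  if h : α₂ - α₁ ≤ 1 / (T : ℕ) then do
    let μ₂ ← Prog.estimate α₂ (numSamples T Δ)
    return [⟨α₁, α₂, 0, μ₂⟩]
  else do
    let μ₁ ← Prog.estimate α₁ (numSamples T Δ)
    let μ₂ ← Prog.estimate α₂ (numSamples T Δ)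
    if μ₂ - μ₁ ≥ Δ then do
      let l ← findJumps T Δ α₁ ((α₁ + α₂) / 2)
      let r ← findJumps T Δ ((α₁ + α₂) / 2) α₂
      return l ++ r
    else
      return [⟨α₁, α₂, μ₁, μ₂⟩]
termination_by ⌊(α₂ - α₁) * (T : ℕ)⌋₊
decreasing_by
  · have := floor_half_lt T h
    rwa [show (α₁ + α₂) / 2 - α₁ = (α₂ - α₁) / 2 by ring]
  · have := floor_half_lt T h
    rwa [show α₂ - (α₁ + α₂) / 2 = (α₂ - α₁) / 2 by ring]

/-- First macro block: `Find-Jumps` on every interval of a collection. Collections of intervals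
are lists of pairs of extremes, processed in order. -/
def findAllJumps (T : ℕ+) (Δ : ℝ) : List (ℝ × ℝ) → Prog (List Triplet)
  | [] => return []
  | J :: Js => do
    let l ← findJumps T Δ J.1 J.2
    let r ← findAllJumps T Δ Js
    return l ++ r

/-- Second macro block: the largest estimated reward (and at least `0`) over all the extremes. -/
def optEstimate (ell : ℝ → ℝ) (l : List Triplet) : ℝ :=
  l.foldl (fun o τ => max (max o (ell τ.α₁ * τ.μ₁)) (ell τ.α₂ * τ.μ₂)) 0

/-- The actions of the interval of `τ` that are optimistically good enough. -/
def shrinkSet (ell : ℝ → ℝ) (T : ℕ+) (Δ opt : ℝ) (τ : Triplet) : Set ℝ :=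
  {α ∈ Icc τ.α₁ τ.α₂ | ell α * τ.μ₁ + 2 * Δ + 2 / (T : ℕ) ≥ opt}

/-- For affine `ell` the set of good actions is a compact interval, so that it is represented
faithfully by its extremes. -/
theorem shrinkSet_eq_Icc (ell : ℝ →ᵃ[ℝ] ℝ) (T : ℕ+) (Δ opt : ℝ) (τ : Triplet)
    (h : (shrinkSet ell T Δ opt τ).Nonempty) :
    shrinkSet ell T Δ opt τ =
      Icc (sInf (shrinkSet ell T Δ opt τ)) (sSup (shrinkSet ell T Δ opt τ)) := by
  have hc : Continuous ell := ell.continuous_of_finiteDimensional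
  apply eq_Icc_of_connected_compact
  · refine ⟨h, ?_⟩
    apply Convex.isPreconnected
    intro x hx y hy a b ha hb hab
    refine ⟨convex_Icc _ _ hx.1 hy.1 ha hb hab, ?_⟩
    have e : ell (a • x + b • y) = a • ell x + b • ell y :=
      Convex.combo_affine_apply hab
    have h1 := mul_le_mul_of_nonneg_left hx.2 ha
    have h2 := mul_le_mul_of_nonneg_left hy.2 hb
    rw [e]
    simp only [smul_eq_mul]
    obtain rfl : b = 1 - a := by linarith
    nlinarith
  · apply isCompact_Icc.of_isClosed_subset _ (sep_subset _ _)
    have h2 : Continuous fun α => ell α * τ.μ₁ + 2 * Δ + 2 / ((T : ℕ) : ℝ) := by fun_prop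
    exact isClosed_Icc.inter (isClosed_le (continuous_const (y := opt)) h2)

/-- `Optimistic-Shrink`: returns a collection of at most one interval. -/
def optimisticShrink (ell : ℝ → ℝ) (T : ℕ+) (Δ opt : ℝ) (τ : Triplet) : List (ℝ × ℝ) :=
  if τ.α₂ - τ.α₁ ≤ 1 / (T : ℕ) ∧ ell τ.α₂ * τ.μ₂ + Δ / 2 + 1 / (T : ℕ) ≥ opt then
    [(τ.α₁, τ.α₂)]
  else if τ.α₂ - τ.α₁ > 1 / (T : ℕ) ∧ (shrinkSet ell T Δ opt τ).Nonempty then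
    [(sInf (shrinkSet ell T Δ opt τ), sSup (shrinkSet ell T Δ opt τ))]
  else []

/-- Epochs `j, j + 1, …, j + m - 1` of RJI-OS, started with the collection `Js` of intervals. -/
def epochs (ell : ℝ → ℝ) (T : ℕ+) : ℕ → ℕ → List (ℝ × ℝ) → Prog Unit
  | 0, _, _ => return ()
  | m + 1, j, Js => do
    let Δ : ℝ := 1 / 2 ^ j
    let l ← findAllJumps T Δ Js
    let opt := optEstimate ell l
    epochs ell T m (j + 1) (l.flatMap (optimisticShrink ell T Δ opt))

/-- The policy of RJI-OS. The learner knows only `ell` and `T`. For feedback in `[0,1]` the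
collection of intervals is never empty, so every epoch takes at least one round, and `T` epochs
fill all the `T` rounds; whatever would be played later is irrelevant. -/
def rjiOS (ell : ℝ → ℝ) (T : ℕ+) : Policy :=
  (epochs ell T T 1 [(0, 1)]).toPolicy

end BwMJ

end

noncomputable section

open MeasureTheory ProbabilityTheory Set
open scoped Classical

namespace BwMJ

namespace Instance

variable {n : ℕ} (I : Instance n)

/-! ### Elementary facts about instances -/

/-! All samples `ω (t, i)` exist beforehand, so every estimate of the algorithm is one of finitely
many non-adaptive window averages, whatever the past. Hoeffding and a union bound over start times,
distributions and about `log T` epochs make all of them accurate to `Δ / 4` outside an event of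
probability `O(n log T / T)` (`measureReal_badEvent_le`). That event contributes `O(n log T)`, since
the regret never exceeds `T`; the rest is deterministic.

With accurate estimates, Find-Jumps splits an interval only if it contains a jump, because an
observed gap `Δ` exceeds the total error `Δ / 2`. Each level of halving thus splits at most as many
intervals as there are jumps, and `d` levels suffice if `T ≤ 2 ^ d`. Since jumps are additive under
subdivision, the collection grows by at most `d * n` intervals per epoch, and an epoch with `N`
samples per estimate takes `O(d² n N)` rounds (`run_findAllJumps_time_le`). The sizes of the jumps
never enter.

On a long interval that is not split, the left estimate controls all rewards up to `5Δ/4`; on a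
short one the right estimate does, because `ell` varies by at most `1 / T`. Hence shrinking keeps an
optimal action and leaves only actions of regret at most `4Δ + 3/T` (`sound_flatMap`), which is `8Δ
+ 3/T` for the halved `Δ` of the next epoch.

As `N Δ` is of order `2 ^ j log T`, the epochs with `Δ > ε` sum geometrically to `O(d² n log T /
ε)`, and all other rounds contribute `O(ε T)` (`cost_epochs_le`). The value `ε = log T * √(n / T)`
gives the claim when `n < T`; otherwise the bound is trivial.

The regret is an integral, so the actions must be shown measurable. This is done for parametrized
families of programs (`MeasFam`): times, indices and list lengths are countable and can be fixed one
value at a time. -/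

theorem mem_actionInterval_iff {i : Fin n} {α : ℝ} :
    α ∈ I.actionInterval i ↔ I.bp i.castSucc ≤ α ∧
      (α < I.bp i.succ ∨ ((i : ℕ) + 1 = n ∧ α ≤ I.bp i.succ)) := by
  unfold actionInterval
  split_ifs with h
  · simp only [mem_Icc, h, true_and]
    exact ⟨fun h => ⟨h.1, Or.inr h.2⟩, fun h => ⟨h.1, h.2.elim le_of_lt id⟩⟩
  · simp [h]

theorem actionInterval_mono {i k : Fin n} {α β : ℝ} (hi : α ∈ I.actionInterval i)
    (hk : β ∈ I.actionInterval k) (h : α ≤ β) : i ≤ k := by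
  rw [mem_actionInterval_iff] at hi hk
  by_contra! hlt
  have hlt' : (k : ℕ) < i := hlt
  have h1 : I.bp k.succ ≤ I.bp i.castSucc := by
    apply I.bp_strictMono.monotone
    rw [Fin.le_def]
    simpa using hlt'
  rcases hk.2 with h2 | h2
  · linarith [hi.1]
  · have := i.2
    omega

theorem exists_mem_actionInterval [NeZero n] {α : ℝ} (hα : α ∈ Icc (0 : ℝ) 1) :
    ∃ i, α ∈ I.actionInterval i := by
  have hne : (Finset.univ.filter fun i : Fin n => I.bp i.castSucc ≤ α).Nonempty := by
    refine ⟨0, ?_⟩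
    simp only [Finset.mem_filter, Finset.mem_univ, true_and]
    have : (0 : Fin n).castSucc = 0 := rfl
    rw [this, I.bp_zero]
    exact hα.1
  obtain ⟨i, hi, hmax⟩ := Finset.exists_max_image _ id hne
  simp only [Finset.mem_filter, Finset.mem_univ, true_and] at hi hmax
  refine ⟨i, I.mem_actionInterval_iff.2 ⟨hi, ?_⟩⟩
  by_cases hn : (i : ℕ) + 1 = n
  · right
    refine ⟨hn, ?_⟩
    have : i.succ = Fin.last n := by
      ext
      simpa using hn
    rw [this, I.bp_last]
    exact hα.2
  · left
    by_contra! hle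
    have hlt : (i : ℕ) + 1 < n := by omega
    have h2 := hmax ⟨i + 1, hlt⟩ hle
    have h3 : (i : ℕ) + 1 ≤ i := h2
    omega

theorem index_eq_of_mem [NeZero n] {α : ℝ} {i : Fin n} (h : α ∈ I.actionInterval i) :
    I.index α = i := by
  unfold index
  rw [Finset.sum_eq_single i]
  · simp [h]
  · intro k _ hk
    rw [if_neg]
    intro hk'
    exact hk (le_antisymm (I.actionInterval_mono hk' h le_rfl)
      (I.actionInterval_mono h hk' le_rfl))
  · simp

theorem mem_actionInterval_index [NeZero n] {α : ℝ} (hα : α ∈ Icc (0 : ℝ) 1) :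
    α ∈ I.actionInterval (I.index α) := by
  obtain ⟨i, hi⟩ := I.exists_mem_actionInterval hα
  rwa [I.index_eq_of_mem hi]

theorem index_mono [NeZero n] {α β : ℝ} (h0 : 0 ≤ α) (h : α ≤ β) (h1 : β ≤ 1) :
    I.index α ≤ I.index β :=
  I.actionInterval_mono (I.mem_actionInterval_index ⟨h0, h.trans h1⟩)
    (I.mem_actionInterval_index ⟨h0.trans h, h1⟩) h

theorem bp_mem (i : Fin (n + 1)) : I.bp i ∈ Icc (0 : ℝ) 1 := by
  constructor
  · rw [← I.bp_zero]
    exact I.bp_strictMono.monotone (Fin.zero_le _)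
  · rw [← I.bp_last]
    exact I.bp_strictMono.monotone (Fin.le_last _)

theorem index_bp [NeZero n] (i : Fin n) : I.index (I.bp i.castSucc) = i := by
  apply I.index_eq_of_mem
  rw [mem_actionInterval_iff]
  exact ⟨le_rfl, Or.inl (I.bp_strictMono (Fin.castSucc_lt_succ))⟩

theorem measurableSet_actionInterval (i : Fin n) : MeasurableSet (I.actionInterval i) := by
  unfold actionInterval
  split_ifs <;> measurability

/-- The index factors through the finitely many truth values of membership in the action intervals.
-/
theorem measurable_index [NeZero n] : Measurable I.index := by
  have h1 : Measurable fun (α : ℝ) (i : Fin n) => α ∈ I.actionInterval i :=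
    measurable_pi_iff.2 fun i => measurableSet_setOfPred.1 (I.measurableSet_actionInterval i)
  have h2 : Measurable fun P : Fin n → Prop => ∑ i : Fin n, if P i then i else 0 :=
    measurable_of_finite _
  exact h2.comp h1

theorem mean_mono {i k : Fin n} (h : i ≤ k) : I.mean i ≤ I.mean k :=
  I.mean_strictMono.monotone h

theorem mean_mem (i : Fin n) : I.mean i ∈ Icc (0 : ℝ) 1 := by
  have hint : Integrable (fun x : ℝ => x) (I.ν i) :=
    Integrable.of_mem_Icc 0 1 measurable_id.aemeasurable (I.ν_supp i)
  constructor
  · exact integral_nonneg_of_ae ((I.ν_supp i).mono fun x hx => hx.1)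
  · calc I.mean i ≤ ∫ _, (1 : ℝ) ∂(I.ν i) :=
          integral_mono_ae hint (integrable_const _) ((I.ν_supp i).mono fun x hx => hx.2)
      _ = 1 := by simp

theorem ell_apply (x : ℝ) : I.ell x = I.ell 0 + x * (I.ell 1 - I.ell 0) := by
  have h := I.ell.apply_lineMap 0 1 x
  simp only [AffineMap.lineMap_apply, vsub_eq_sub, sub_zero, smul_eq_mul, mul_one, vadd_eq_add,
    add_zero] at h
  linarith

theorem ell_slope_neg : I.ell 1 - I.ell 0 < 0 := by
  have := I.ell_strictAnti (a := 0) (b := 1) (by simp) (by simp) zero_lt_one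
  linarith

theorem ell_anti {x y : ℝ} (h : x ≤ y) : I.ell y ≤ I.ell x := by
  rw [I.ell_apply x, I.ell_apply y]
  nlinarith [I.ell_slope_neg]

/-- An affine map of `[0,1]` into itself has slope at least `-1`. -/
theorem ell_le_add {x y : ℝ} (h : x ≤ y) : I.ell x ≤ I.ell y + (y - x) := by
  rw [I.ell_apply x, I.ell_apply y]
  have h0 := I.ell_mapsTo (x := 0) (by simp)
  have h1 := I.ell_mapsTo (x := 1) (by simp)
  nlinarith [h0.2, h1.1]

variable [NeZero n]

/-- The expected feedback of an action. -/
def m (α : ℝ) : ℝ := I.mean (I.index α)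

theorem u_eq (α : ℝ) : I.u α = I.ell α * I.m α := rfl

theorem m_mono {α β : ℝ} (h0 : 0 ≤ α) (h : α ≤ β) (h1 : β ≤ 1) : I.m α ≤ I.m β :=
  I.mean_mono (I.index_mono h0 h h1)

theorem m_mem (α : ℝ) : I.m α ∈ Icc (0 : ℝ) 1 := I.mean_mem _

theorem u_mem {α : ℝ} (hα : α ∈ Icc (0 : ℝ) 1) : I.u α ∈ Icc (0 : ℝ) 1 := by
  have h1 := I.ell_mapsTo hα
  have h2 := I.m_mem α
  exact ⟨mul_nonneg h1.1 h2.1, mul_le_one₀ h1.2 h2.1 h2.2⟩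

theorem u_le_OPT {α : ℝ} (hα : α ∈ Icc (0 : ℝ) 1) : I.u α ≤ I.OPT := by
  apply le_csSup
  · refine ⟨1, ?_⟩
    rintro _ ⟨x, hx, rfl⟩
    exact (I.u_mem hx).2
  · exact ⟨α, hα, rfl⟩

theorem OPT_mem : I.OPT ∈ Icc (0 : ℝ) 1 := by
  constructor
  · exact (I.u_mem (α := 0) (by simp)).1.trans (I.u_le_OPT (by simp))
  · apply csSup_le ((nonempty_Icc.2 zero_le_one).image _)
    rintro _ ⟨x, hx, rfl⟩
    exact (I.u_mem hx).2

/-- The mean is constant on an action interval and `ell` decreases, so the left breakpoint is best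
there and only finitely many candidates remain. -/
theorem exists_u_eq_OPT : ∃ α ∈ Icc (0 : ℝ) 1, I.u α = I.OPT := by
  obtain ⟨i, -, hi⟩ := Finset.exists_max_image Finset.univ
    (fun i : Fin n => I.u (I.bp i.castSucc)) ⟨0, Finset.mem_univ _⟩
  refine ⟨_, I.bp_mem i.castSucc, le_antisymm (I.u_le_OPT (I.bp_mem _)) ?_⟩
  apply csSup_le ((nonempty_Icc.2 zero_le_one).image _)
  rintro _ ⟨x, hx, rfl⟩
  refine le_trans ?_ (hi (I.index x) (Finset.mem_univ _))
  rw [u, u, I.index_bp]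
  apply mul_le_mul_of_nonneg_right _ (I.mean_mem _).1
  exact I.ell_anti (I.mem_actionInterval_iff.1 (I.mem_actionInterval_index hx)).1

theorem measurable_u : Measurable I.u := by
  have h1 : Measurable I.ell := I.ell.continuous_of_finiteDimensional.measurable
  exact h1.mul ((measurable_of_finite I.mean).comp I.measurable_index)

/-! ### Executions of a program along a realization of the environment -/

variable (ω : ℕ × Fin n → ℝ)

/-- The result and the final time of the execution of a program started at time `s`. -/
def run {β : Type} : Prog β → ℕ → β × ℕ
  | .ret b, s => (b, s)
  | .play a k, s => run (k (ω (s, I.index a))) (s + 1)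

/-- The action played `t` rounds after the start, at time `s`, of a program. -/
def act {β : Type} : Prog β → ℕ → ℕ → ℝ
  | .ret _, _, _ => 0
  | .play a _, _, 0 => a
  | .play a k, s, t + 1 => act (k (ω (s, I.index a))) (s + 1) t

/-- The regret accumulated before time `T` by a program started at time `s`. -/
def cost (T : ℕ) {β : Type} : Prog β → ℕ → ℝ
  | .ret _, _ => 0
  | .play a k, s =>
    (if s < T then I.OPT - I.u a else 0) + cost T (k (ω (s, I.index a))) (s + 1)

/-- The history of the first `t` rounds of a program started at time `s`. -/
def progHistory {β : Type} : Prog β → ℕ → ℕ → List (ℝ × ℝ)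
  | _, _, 0 => []
  | .ret b, s, t + 1 => (0, ω (s, I.index 0)) :: progHistory (.ret b) (s + 1) t
  | .play a k, s, t + 1 =>
    (a, ω (s, I.index a)) :: progHistory (k (ω (s, I.index a))) (s + 1) t

variable {β γ : Type}

theorem toPolicy_progHistory (p : Prog β) (s t : ℕ) :
    p.toPolicy (I.progHistory ω p s t) = I.act ω p s t := by
  induction t generalizing p s with
  | zero => cases p <;> simp [progHistory, Prog.toPolicy, act]
  | succ t ih =>
    cases p with
    | ret b => simp [Prog.toPolicy, act]
    | play a k => simp [progHistory, Prog.toPolicy, act, ih]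

theorem progHistory_succ (p : Prog β) (s t : ℕ) :
    I.progHistory ω p s (t + 1) = I.progHistory ω p s t ++
      [(I.act ω p s t, ω (s + t, I.index (I.act ω p s t)))] := by
  induction t generalizing p s with
  | zero => cases p <;> simp [progHistory, act]
  | succ t ih =>
    cases p with
    | ret b =>
      rw [progHistory, ih, progHistory]
      simp [act, add_assoc, add_comm 1]
    | play a k =>
      rw [progHistory, ih, progHistory]
      simp [act, add_assoc, add_comm 1]

/-- Replaces the policy, which replays the whole history in every round, by the direct recursive
execution of the program. -/
theorem history_toPolicy (p : Prog β) (t : ℕ) :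
    I.history p.toPolicy ω t = I.progHistory ω p 0 t := by
  induction t with
  | zero => cases p <;> simp [history, progHistory]
  | succ t ih => rw [history, ih, progHistory_succ, toPolicy_progHistory, zero_add]

theorem action_toPolicy (p : Prog β) (t : ℕ) :
    I.action p.toPolicy ω t = I.act ω p 0 t := by
  rw [action, history_toPolicy, toPolicy_progHistory]

@[simp] theorem run_pure (b : β) (s : ℕ) : I.run ω (pure b : Prog β) s = (b, s) := rfl

@[simp] theorem cost_pure (T : ℕ) (b : β) (s : ℕ) :
    I.cost ω T (pure b : Prog β) s = 0 := rfl

@[simp] theorem run_bind (p : Prog β) (f : β → Prog γ) (s : ℕ) :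
    I.run ω (p >>= f) s = I.run ω (f (I.run ω p s).1) (I.run ω p s).2 := by
  change I.run ω (Prog.bind p f) s = _
  induction p generalizing s with
  | ret b => rfl
  | play a k ih => simp [Prog.bind, run, ih]

@[simp] theorem cost_bind (T : ℕ) (p : Prog β) (f : β → Prog γ) (s : ℕ) :
    I.cost ω T (p >>= f) s =
      I.cost ω T p s + I.cost ω T (f (I.run ω p s).1) (I.run ω p s).2 := by
  change I.cost ω T (Prog.bind p f) s = _
  induction p generalizing s with
  | ret b => simp [Prog.bind, cost, run]
  | play a k ih => simp [Prog.bind, run, cost, ih, add_assoc]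

theorem le_run_snd (p : Prog β) (s : ℕ) : s ≤ (I.run ω p s).2 := by
  induction p generalizing s with
  | ret b => exact le_rfl
  | play a k ih => exact (Nat.le_succ s).trans (ih _ _)

theorem act_bind (p : Prog β) (f : β → Prog γ) (s t : ℕ) :
    I.act ω (p >>= f) s t =
      if (I.run ω p s).2 ≤ s + t then
        I.act ω (f (I.run ω p s).1) (I.run ω p s).2 (s + t - (I.run ω p s).2)
      else I.act ω p s t := by
  change I.act ω (Prog.bind p f) s t = _
  induction p generalizing s t with
  | ret b => simp [Prog.bind, run]
  | play a k ih =>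
    cases t with
    | zero =>
      have := I.le_run_snd ω (k (ω (s, I.index a))) (s + 1)
      rw [if_neg (by simp only [run]; omega)]
      simp [Prog.bind, act]
    | succ t =>
      simp only [Prog.bind, act, run, ih, show s + (t + 1) = s + 1 + t by omega]

theorem cost_eq_zero {T : ℕ} (p : Prog β) {s : ℕ} (h : T ≤ s) : I.cost ω T p s = 0 := by
  induction p generalizing s with
  | ret b => rfl
  | play a k ih => rw [cost, ih _ (by omega), if_neg (by omega), add_zero]

/-- A program that lasts until `T` never reaches the default action `0` within the horizon, which
`cost` would not charge. -/
theorem sum_act_eq_cost {T : ℕ} (p : Prog β) {s : ℕ} (h : T ≤ (I.run ω p s).2) :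
    ∑ t ∈ Finset.range (T - s), (I.OPT - I.u (I.act ω p s t)) = I.cost ω T p s := by
  induction p generalizing s with
  | ret b =>
    have h' : T ≤ s := h
    simp [Nat.sub_eq_zero_of_le h', cost]
  | play a k ih =>
    have h2 := ih (ω (s, I.index a)) (s := s + 1) h
    rw [cost, ← h2]
    by_cases hs : s < T
    · rw [show T - s = (T - (s + 1)) + 1 by omega, Finset.sum_range_succ', if_pos hs, add_comm]
      rfl
    · rw [show T - s = 0 by omega, show T - (s + 1) = 0 by omega]
      simp [hs]

@[simp] theorem run_sampleSum (a : ℝ) (N s : ℕ) :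
    I.run ω (Prog.sampleSum a N) s =
      (∑ t ∈ Finset.range N, ω (s + t, I.index a), s + N) := by
  induction N generalizing s with
  | zero => simp [Prog.sampleSum, run]
  | succ N ih =>
    rw [Prog.sampleSum, run, run_bind, ih, Finset.sum_range_succ']
    simp [add_assoc, add_comm 1, add_comm (ω (s, I.index a))]

@[simp] theorem run_estimate (a : ℝ) (N s : ℕ) :
    I.run ω (Prog.estimate a N) s =
      ((∑ t ∈ Finset.range N, ω (s + t, I.index a)) / N, s + N) := by
  simp [Prog.estimate]

end Instance

/-! ### Invariants of programs -/

/-- Whatever the feedback, every action played satisfies `P` and the result satisfies `Q`. -/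
def Prog.All {β : Type} (P : ℝ → Prop) (Q : β → Prop) : Prog β → Prop
  | .ret b => Q b
  | .play a k => P a ∧ ∀ x, Prog.All P Q (k x)

namespace Prog

variable {β γ : Type} {P : ℝ → Prop}

theorem All.bind {Q : β → Prop} {R : γ → Prop} {p : Prog β} {f : β → Prog γ}
    (hp : p.All P Q) (hf : ∀ b, Q b → (f b).All P R) : (p >>= f).All P R := by
  change (Prog.bind p f).All P R
  induction p with
  | ret b => exact hf b hp
  | play a k ih => exact ⟨hp.1, fun x => ih x (hp.2 x)⟩

theorem All.pure {Q : β → Prop} {b : β} (h : Q b) : (pure b : Prog β).All P Q := h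

theorem All.sampleSum {a : ℝ} (h : P a) (N : ℕ) :
    (Prog.sampleSum a N).All P fun _ => True := by
  induction N with
  | zero => trivial
  | succ N ih => exact ⟨h, fun x => ih.bind fun _ _ => trivial⟩

theorem All.estimate {a : ℝ} (h : P a) (N : ℕ) :
    (Prog.estimate a N).All P fun _ => True :=
  (All.sampleSum h N).bind fun _ _ => trivial

theorem All.run {n : ℕ} [NeZero n] (I : Instance n) (ω : ℕ × Fin n → ℝ) {Q : β → Prop}
    {p : Prog β} (h : p.All P Q) (s : ℕ) : Q (I.run ω p s).1 := by
  induction p generalizing s with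
  | ret b => exact h
  | play a k ih => exact ih _ (h.2 _) _

theorem All.act {n : ℕ} [NeZero n] (I : Instance n) (ω : ℕ × Fin n → ℝ) {Q : β → Prop}
    {p : Prog β} (h : p.All P Q) (h0 : P 0) (s t : ℕ) : P (I.act ω p s t) := by
  induction p generalizing s t with
  | ret b => exact h0
  | play a k ih =>
    cases t with
    | zero => exact h.1
    | succ t => exact ih _ (h.2 _) _ _

/-- Both times are truncated at `T`, so that rounds beyond the horizon are not charged and the
bounds of consecutive programs telescope. -/
theorem All.cost_le {n : ℕ} [NeZero n] (I : Instance n) (ω : ℕ × Fin n → ℝ) (T : ℕ)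
    {Q : β → Prop} {g : ℝ} {p : Prog β} (h : p.All (fun a => I.OPT - I.u a ≤ g) Q) (s : ℕ) :
    I.cost ω T p s ≤ g * ((min (I.run ω p s).2 T : ℕ) - (min s T : ℕ) : ℝ) := by
  induction p generalizing s with
  | ret b => simp [Instance.cost, Instance.run]
  | play a k ih =>
    have h2 := ih _ (h.2 (ω (s, I.index a))) (s + 1)
    simp only [Instance.cost, Instance.run] at h2 ⊢
    have h3 := h.1
    by_cases hs : s < T
    · have e1 : min (s + 1) T = s + 1 := by omega
      have e2 : min s T = s := by omega
      rw [e1] at h2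
      rw [e2, if_pos hs]
      push_cast at h2 ⊢
      linarith
    · have e1 : min (s + 1) T = min s T := by omega
      rw [e1] at h2
      rw [if_neg hs]
      linarith

end Prog

/-! ### Measurability of lists -/

/-- A countable case distinction between measurable functions is measurable. -/
theorem measurable_countable_cases {Ω Y ι : Type*} [MeasurableSpace Ω] [MeasurableSpace Y]
    [Countable ι] [MeasurableSpace ι] [MeasurableSingletonClass ι] {c : Ω → ι}
    (hc : Measurable c) {G : ι → Ω → Y} (hG : ∀ i, Measurable (G i)) :
    Measurable fun z => G (c z) z :=
  (measurable_from_prod_countable_right (f := fun p : ι × Ω => G p.1 p.2) hG).comp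
    (hc.prodMk measurable_id)

/-- The `σ`-algebra on lists generated by the length and the entries. -/
instance List.instMeasurableSpace {X : Type*} [MeasurableSpace X] [Inhabited X] :
    MeasurableSpace (List X) :=
  MeasurableSpace.comap (fun l => (l.length, fun i : ℕ => l.getD i default)) inferInstance

section List

variable {Ω X Y : Type*} [MeasurableSpace Ω] [MeasurableSpace X] [Inhabited X]
  [MeasurableSpace Y]

theorem measurable_list_iff {f : Ω → List X} :
    Measurable f ↔ Measurable (fun z => (f z).length) ∧
      ∀ i : ℕ, Measurable fun z => (f z).getD i default := by
  rw [measurable_comap_iff]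
  constructor
  · intro h
    exact ⟨h.fst, fun i => (measurable_pi_apply i).comp h.snd⟩
  · rintro ⟨h1, h2⟩
    exact h1.prodMk (measurable_pi_iff.2 h2)

theorem measurable_list_append {f g : Ω → List X} (hf : Measurable f) (hg : Measurable g) :
    Measurable fun z => f z ++ g z := by
  rw [measurable_list_iff] at hf hg ⊢
  constructor
  · simp only [List.length_append]
    exact hf.1.add hg.1
  · intro i
    have h1 : Measurable fun z => (g z).getD (i - (f z).length) default :=
      measurable_countable_cases hf.1 (G := fun k z => (g z).getD (i - k) default)
        fun k => hg.2 _
    have h2 : MeasurableSet {z | i < (f z).length} := measurableSet_lt measurable_const hf.1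
    have h3 : (fun z => (f z ++ g z).getD i default) = fun z => if i < (f z).length then
        (f z).getD i default else (g z).getD (i - (f z).length) default := by
      ext z
      split_ifs with h
      · exact List.getD_append _ _ _ _ h
      · exact List.getD_append_right _ _ _ _ (not_lt.1 h)
    rw [h3]
    exact Measurable.ite h2 (hf.2 i) h1

theorem measurable_list_singleton {x : Ω → X} (hx : Measurable x) :
    Measurable fun z => [x z] := by
  rw [measurable_list_iff]
  refine ⟨by simp, fun i => ?_⟩
  cases i with
  | zero => simpa using hx
  | succ i => simp

/-- A function of a list is measurable if it is so for lists of any given length. -/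
theorem measurable_of_ofFn {F : Ω → List X → Y} {l : Ω → List X} (hl : Measurable l)
    (h : ∀ (k : ℕ) (x : Fin k → Ω → X), (∀ i, Measurable (x i)) →
      Measurable fun z => F z (List.ofFn fun i => x i z)) :
    Measurable fun z => F z (l z) := by
  rw [measurable_list_iff] at hl
  -- A list of length `k` is the `ofFn` of its first `k` entries, and there are countably many
  -- lengths.
  convert measurable_countable_cases hl.1
    (G := fun k z => F z (List.ofFn fun i : Fin k => (l z).getD i default))
    (fun k => h k _ fun i => hl.2 i) using 2 with z
  congr 1
  apply List.ext_getElem <;> simp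

end List

/-! ### Measurable families of programs -/

namespace Instance

variable {n : ℕ} [NeZero n] (I : Instance n) {Θ Θ' β γ : Type} [MeasurableSpace Θ]
  [MeasurableSpace Θ'] [MeasurableSpace β] [MeasurableSpace γ]

/-- A family of programs whose executions depend measurably on the parameter and on the
environment. -/
def MeasFam (p : Θ → Prog β) : Prop :=
  (∀ s, Measurable fun z : Θ × (ℕ × Fin n → ℝ) => I.run z.2 (p z.1) s) ∧
    ∀ s t, Measurable fun z : Θ × (ℕ × Fin n → ℝ) => I.act z.2 (p z.1) s t

variable {I}

namespace MeasFam

theorem pure {b : Θ → β} (hb : Measurable b) : I.MeasFam fun θ => (pure (b θ) : Prog β) :=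
  ⟨fun _ => (hb.comp measurable_fst).prodMk measurable_const, fun _ _ => measurable_const⟩

theorem comp {p : Θ → Prog β} (hp : I.MeasFam p) {φ : Θ' → Θ} (hφ : Measurable φ) :
    I.MeasFam fun θ => p (φ θ) := by
  have h : Measurable fun z : Θ' × (ℕ × Fin n → ℝ) => (φ z.1, z.2) :=
    (hφ.comp measurable_fst).prodMk measurable_snd
  exact ⟨fun s => (hp.1 s).comp h, fun s t => (hp.2 s t).comp h⟩

/-- The index of the action takes finitely many values, and for a fixed one the feedback is a
coordinate of the environment. -/
theorem play {a : Θ → ℝ} (ha : Measurable a) {k : Θ → ℝ → Prog β}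
    (hk : I.MeasFam fun q : Θ × ℝ => k q.1 q.2) :
    I.MeasFam fun θ => Prog.play (a θ) (k θ) := by
  have h (s : ℕ) : Measurable fun z : Θ × (ℕ × Fin n → ℝ) =>
      ((z.1, z.2 (s, I.index (a z.1))), z.2) := by
    refine (measurable_fst.prodMk ?_).prodMk measurable_snd
    exact measurable_countable_cases (I.measurable_index.comp (ha.comp measurable_fst))
      (G := fun (i : Fin n) (z : Θ × (ℕ × Fin n → ℝ)) => z.2 (s, i))
      fun i => (measurable_pi_apply _).comp measurable_snd
  refine ⟨fun s => (hk.1 (s + 1)).comp (h s), fun s t => ?_⟩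
  cases t with
  | zero => exact ha.comp measurable_fst
  | succ t => exact (hk.2 (s + 1) t).comp (h s)

/-- The continuation starts at a random time; times are countable, so it suffices to treat each
fixed starting time. -/
theorem bind {p : Θ → Prog β} (hp : I.MeasFam p) {f : Θ → β → Prog γ}
    (hf : I.MeasFam fun q : Θ × β => f q.1 q.2) : I.MeasFam fun θ => p θ >>= f θ := by
  have h (s : ℕ) : Measurable fun z : Θ × (ℕ × Fin n → ℝ) =>
      ((z.1, (I.run z.2 (p z.1) s).1), z.2) :=
    (measurable_fst.prodMk (hp.1 s).fst).prodMk measurable_snd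
  have he (s : ℕ) : Measurable fun z : Θ × (ℕ × Fin n → ℝ) => (I.run z.2 (p z.1) s).2 :=
    (hp.1 s).snd
  refine ⟨fun s => ?_, fun s t => ?_⟩
  · simp only [run_bind]
    exact measurable_countable_cases (he s)
      (G := fun (e : ℕ) (z : Θ × (ℕ × Fin n → ℝ)) =>
        I.run z.2 (f z.1 (I.run z.2 (p z.1) s).1) e)
      fun e => (hf.1 e).comp (h s)
  · simp only [act_bind]
    refine Measurable.ite (measurableSet_le (he s) measurable_const) ?_ (hp.2 s t)
    exact measurable_countable_cases (he s)
      (G := fun (e : ℕ) (z : Θ × (ℕ × Fin n → ℝ)) =>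
        I.act z.2 (f z.1 (I.run z.2 (p z.1) s).1) e (s + t - e))
      fun e => (hf.2 e _).comp (h s)

theorem countable_cases {c : Θ → ℕ} (hc : Measurable c) {q : ℕ → Θ → Prog β}
    (hq : ∀ k, I.MeasFam (q k)) : I.MeasFam fun θ => q (c θ) θ :=
  ⟨fun s => measurable_countable_cases (hc.comp measurable_fst)
      (G := fun k (z : Θ × (ℕ × Fin n → ℝ)) => I.run z.2 (q k z.1) s) fun k => (hq k).1 s,
    fun s t => measurable_countable_cases (hc.comp measurable_fst)
      (G := fun k (z : Θ × (ℕ × Fin n → ℝ)) => I.act z.2 (q k z.1) s t) fun k => (hq k).2 s t⟩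

theorem ite {c : Θ → Prop} (hc : MeasurableSet {θ | c θ}) {p q : Θ → Prog β}
    (hp : I.MeasFam p) (hq : I.MeasFam q) : I.MeasFam fun θ => if c θ then p θ else q θ := by
  have h := countable_cases (I := I) (c := fun θ => if c θ then 0 else 1)
    (Measurable.ite hc measurable_const measurable_const)
    (q := fun k => if k = 0 then p else q) (fun k => by split_ifs <;> assumption)
  convert h using 2 with θ
  split_ifs <;> simp_all

theorem sampleSum {a : Θ → ℝ} (ha : Measurable a) (N : ℕ) :
    I.MeasFam fun θ => Prog.sampleSum (a θ) N := by
  induction N generalizing Θ with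
  | zero => exact pure measurable_const
  | succ N ih =>
    refine play ha (bind (ih (ha.comp measurable_fst)) ?_)
    exact pure (measurable_fst.snd.add measurable_snd)

theorem estimate {a : Θ → ℝ} (ha : Measurable a) (N : ℕ) :
    I.MeasFam fun θ => Prog.estimate (a θ) N :=
  bind (sampleSum ha N) (pure (measurable_snd.div_const _))

end MeasFam

end Instance

/-! ### Measurability of the policy of RJI-OS -/

instance : Inhabited Triplet := ⟨⟨0, 0, 0, 0⟩⟩

/-- The `σ`-algebra on triplets generated by the components. -/
instance Triplet.instMeasurableSpace : MeasurableSpace Triplet :=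
  MeasurableSpace.comap (fun τ => (τ.α₁, τ.α₂, τ.μ₁, τ.μ₂)) inferInstance

theorem measurable_triplet_iff {Ω : Type*} [MeasurableSpace Ω] {f : Ω → Triplet} :
    Measurable f ↔ Measurable (fun z => (f z).α₁) ∧ Measurable (fun z => (f z).α₂) ∧
      Measurable (fun z => (f z).μ₁) ∧ Measurable fun z => (f z).μ₂ := by
  rw [measurable_comap_iff]
  exact ⟨fun h => ⟨h.fst, h.snd.fst, h.snd.snd.fst, h.snd.snd.snd⟩,
    fun h => h.1.prodMk (h.2.1.prodMk (h.2.2.1.prodMk h.2.2.2))⟩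

theorem measurable_optEstimate {Ω : Type*} [MeasurableSpace Ω] {ell : ℝ → ℝ}
    (hell : Measurable ell) {l : Ω → List Triplet} (hl : Measurable l) :
    Measurable fun z => optEstimate ell (l z) := by
  unfold optEstimate
  refine measurable_of_ofFn (F := fun (_ : Ω) l =>
    List.foldl (fun o τ => max (max o (ell τ.α₁ * τ.μ₁)) (ell τ.α₂ * τ.μ₂)) 0 l) hl ?_
  suffices ∀ (k : ℕ) (o : Ω → ℝ) (x : Fin k → Ω → Triplet), Measurable o →
      (∀ i, Measurable (x i)) → Measurable fun z =>
        (List.ofFn fun i => x i z).foldl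
          (fun o τ => max (max o (ell τ.α₁ * τ.μ₁)) (ell τ.α₂ * τ.μ₂)) (o z) from
    fun k x hx => this k _ x measurable_const hx
  intro k
  induction k with
  | zero => intro o x ho _; simpa using ho
  | succ k ih =>
    intro o x ho hx
    simp only [List.ofFn_succ, List.foldl_cons]
    have h0 := measurable_triplet_iff.1 (hx 0)
    refine ih _ _ ?_ fun i => hx _
    exact (ho.max ((hell.comp h0.1).mul h0.2.2.1)).max ((hell.comp h0.2.1).mul h0.2.2.2)

theorem measurable_flatMap {Ω X Y : Type*} [MeasurableSpace Ω] [MeasurableSpace X] [Inhabited X]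
    [MeasurableSpace Y] [Inhabited Y] {F : Ω → X → List Y}
    (hF : ∀ x : Ω → X, Measurable x → Measurable fun z => F z (x z)) {l : Ω → List X}
    (hl : Measurable l) : Measurable fun z => (l z).flatMap (F z) := by
  refine measurable_of_ofFn (F := fun z l => l.flatMap (F z)) hl ?_
  intro k
  induction k with
  | zero => intro x _; simp
  | succ k ih =>
    intro x hx
    simp only [List.ofFn_succ, List.flatMap_cons]
    exact measurable_list_append (hF _ (hx 0)) (ih _ fun i => hx _)

namespace Instance

variable {n : ℕ} (I : Instance n)

/-- The left extreme of the set of good actions of a triplet. -/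
def shrinkLeft (T : ℕ+) (Δ opt : ℝ) (τ : Triplet) : ℝ :=
  if τ.μ₁ = 0 then (if 2 * Δ + 2 / (T : ℕ) ≥ opt then τ.α₁ else 1)
  else if τ.μ₁ < 0 then
    max τ.α₁ (((opt - 2 * Δ - 2 / (T : ℕ)) / τ.μ₁ - I.ell 0) / (I.ell 1 - I.ell 0))
  else τ.α₁

/-- The right extreme of the set of good actions of a triplet. -/
def shrinkRight (T : ℕ+) (Δ opt : ℝ) (τ : Triplet) : ℝ :=
  if τ.μ₁ = 0 then (if 2 * Δ + 2 / (T : ℕ) ≥ opt then τ.α₂ else 0)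
  else if τ.μ₁ < 0 then τ.α₂
  else min τ.α₂ (((opt - 2 * Δ - 2 / (T : ℕ)) / τ.μ₁ - I.ell 0) / (I.ell 1 - I.ell 0))

/-- Solves the affine inequality for `α`, so that the extremes are visibly measurable. Arbitrary
real feedback is allowed here, so `τ.μ₁` may be negative, which reverses the inequality. For `τ.μ₁ =
0` the condition does not involve `α`, and the extremes `1` and `0` encode the empty set. -/
theorem shrinkSet_eq (T : ℕ+) (Δ opt : ℝ) (τ : Triplet) :
    shrinkSet I.ell T Δ opt τ = Icc (I.shrinkLeft T Δ opt τ) (I.shrinkRight T Δ opt τ) := by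
  have hq := I.ell_slope_neg
  ext α
  simp only [shrinkSet, shrinkLeft, shrinkRight, mem_ofPred_eq, mem_Icc, ge_iff_le]
  rcases lt_trichotomy τ.μ₁ 0 with h | h | h
  · simp only [h.ne, h, if_true, if_false, max_le_iff]
    have (c : ℝ) : (c ≤ I.ell α * τ.μ₁) ↔
        (c / τ.μ₁ - I.ell 0) / (I.ell 1 - I.ell 0) ≤ α := by
      rw [div_le_iff_of_neg hq, le_sub_iff_add_le, I.ell_apply α, le_div_iff_of_neg h, add_comm]
    rw [← this, show opt ≤ I.ell α * τ.μ₁ + 2 * Δ + 2 / (T : ℕ) ↔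
      opt - 2 * Δ - 2 / (T : ℕ) ≤ I.ell α * τ.μ₁ from ⟨fun h => by linarith, fun h => by linarith⟩]
    tauto
  · simp only [h, if_true, mul_zero, zero_add]
    split_ifs with h2
    · tauto
    · constructor
      · tauto
      · rintro ⟨h3, h4⟩
        linarith
  · simp only [h.ne', h.not_gt, if_false, le_min_iff]
    have (c : ℝ) : (c ≤ I.ell α * τ.μ₁) ↔
        α ≤ (c / τ.μ₁ - I.ell 0) / (I.ell 1 - I.ell 0) := by
      rw [le_div_iff_of_neg hq, sub_le_iff_le_add, I.ell_apply α, div_le_iff₀ h, add_comm]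
    rw [← this, show opt ≤ I.ell α * τ.μ₁ + 2 * Δ + 2 / (T : ℕ) ↔
      opt - 2 * Δ - 2 / (T : ℕ) ≤ I.ell α * τ.μ₁ from ⟨fun h => by linarith, fun h => by linarith⟩]
    tauto

theorem optimisticShrink_eq (T : ℕ+) (Δ opt : ℝ) (τ : Triplet) :
    optimisticShrink I.ell T Δ opt τ =
      if τ.α₂ - τ.α₁ ≤ 1 / (T : ℕ) ∧ opt ≤ I.ell τ.α₂ * τ.μ₂ + Δ / 2 + 1 / (T : ℕ) then
        [(τ.α₁, τ.α₂)]
      else if 1 / (T : ℕ) < τ.α₂ - τ.α₁ ∧ I.shrinkLeft T Δ opt τ ≤ I.shrinkRight T Δ opt τ then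
        [(I.shrinkLeft T Δ opt τ, I.shrinkRight T Δ opt τ)]
      else [] := by
  unfold optimisticShrink
  rw [shrinkSet_eq, nonempty_Icc]
  split_ifs with h1 h2
  · rfl
  · rw [csInf_Icc h2.2, csSup_Icc h2.2]
  · rfl

theorem measurable_ell : Measurable I.ell := I.ell.continuous_of_finiteDimensional.measurable

theorem measurable_optimisticShrink {Ω : Type*} [MeasurableSpace Ω] (T : ℕ+) (Δ : ℝ)
    {opt : Ω → ℝ} (hopt : Measurable opt) {τ : Ω → Triplet} (hτ : Measurable τ) :
    Measurable fun z => optimisticShrink I.ell T Δ (opt z) (τ z) := by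
  have hell := I.measurable_ell
  obtain ⟨h1, h2, h3, h4⟩ := measurable_triplet_iff.1 hτ
  have hμ : MeasurableSet {z | (τ z).μ₁ = 0} := measurableSet_eq_fun h3 measurable_const
  have hμ' : MeasurableSet {z | (τ z).μ₁ < 0} := measurableSet_lt h3 measurable_const
  have hg : MeasurableSet {z | 2 * Δ + 2 / (T : ℕ) ≥ opt z} :=
    measurableSet_le hopt measurable_const
  have hL : Measurable fun z => I.shrinkLeft T Δ (opt z) (τ z) := by
    unfold shrinkLeft
    refine Measurable.ite hμ (Measurable.ite hg h1 measurable_const)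
      (Measurable.ite hμ' ?_ h1)
    fun_prop
  have hR : Measurable fun z => I.shrinkRight T Δ (opt z) (τ z) := by
    unfold shrinkRight
    refine Measurable.ite hμ (Measurable.ite hg h2 measurable_const)
      (Measurable.ite hμ' h2 ?_)
    fun_prop
  simp only [optimisticShrink_eq]
  refine Measurable.ite ?_ (measurable_list_singleton (h1.prodMk h2))
    (Measurable.ite ?_ (measurable_list_singleton (hL.prodMk hR)) measurable_const)
  · exact (measurableSet_le (h2.sub h1) measurable_const).inter
      (measurableSet_le hopt (((((hell.comp h2).mul h4)).add_const _).add_const _))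
  · exact (measurableSet_lt measurable_const (h2.sub h1)).inter (measurableSet_le hL hR)

variable [NeZero n] {I} {Θ : Type} [MeasurableSpace Θ]

/-- A bound on the lengths that is uniform in the parameter turns the well-founded recursion into an
induction on its depth. -/
theorem MeasFam.findJumps_of_le (T : ℕ+) (Δ : ℝ) (k : ℕ) {a b : Θ → ℝ} (ha : Measurable a)
    (hb : Measurable b) (h : ∀ θ, (b θ - a θ) * (T : ℕ) ≤ 2 ^ k) :
    I.MeasFam fun θ => findJumps T Δ (a θ) (b θ) := by
  have hT : (0 : ℝ) < (T : ℕ) := by exact_mod_cast T.pos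
  have hshort : I.MeasFam fun θ => do
      let μ₂ ← Prog.estimate (b θ) (numSamples T Δ)
      return [(⟨a θ, b θ, 0, μ₂⟩ : Triplet)] := by
    refine bind (estimate hb _) (pure (measurable_list_singleton ?_))
    rw [measurable_triplet_iff]
    exact ⟨ha.comp measurable_fst, hb.comp measurable_fst, measurable_const, measurable_snd⟩
  induction k generalizing Θ with
  | zero =>
    convert hshort using 2 with θ
    rw [findJumps, dif_pos]
    rw [le_div_iff₀ hT]
    simpa using h θ
  | succ k ih =>
    have hrec (a' b' : Θ → ℝ) (ha' : Measurable a') (hb' : Measurable b')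
        (h' : ∀ θ, (b' θ - a' θ) * (T : ℕ) ≤ 2 ^ k) :
        I.MeasFam fun θ => findJumps T Δ (a' θ) (b' θ) := by
      refine ih ha' hb' h' (bind (estimate hb' _) (pure (measurable_list_singleton ?_)))
      rw [measurable_triplet_iff]
      exact ⟨ha'.comp measurable_fst, hb'.comp measurable_fst, measurable_const, measurable_snd⟩
    have hl := hrec a (fun θ => (a θ + b θ) / 2) ha ((ha.add hb).div_const _) fun θ => by
      have := h θ
      rw [pow_succ] at this
      nlinarith
    have hr := hrec (fun θ => (a θ + b θ) / 2) b ((ha.add hb).div_const _) hb fun θ => by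
      have := h θ
      rw [pow_succ] at this
      nlinarith
    have hd : MeasurableSet {θ | b θ - a θ ≤ 1 / (T : ℕ)} :=
      measurableSet_le (hb.sub ha) measurable_const
    have hlong : I.MeasFam fun θ => do
        let μ₁ ← Prog.estimate (a θ) (numSamples T Δ)
        let μ₂ ← Prog.estimate (b θ) (numSamples T Δ)
        if μ₂ - μ₁ ≥ Δ then do
          let l ← findJumps T Δ (a θ) ((a θ + b θ) / 2)
          let r ← findJumps T Δ ((a θ + b θ) / 2) (b θ)
          return l ++ r
        else
          return [(⟨a θ, b θ, μ₁, μ₂⟩ : Triplet)] := by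
      refine bind (estimate ha _) (bind (estimate (hb.comp measurable_fst) _) (ite ?_ ?_ ?_))
      · exact measurableSet_le measurable_const (measurable_snd.sub measurable_fst.snd)
      · refine bind (hl.comp measurable_fst.fst) (bind (hr.comp measurable_fst.fst.fst)
          (pure (measurable_list_append measurable_fst.snd measurable_snd)))
      · refine pure (measurable_list_singleton (measurable_triplet_iff.2 ⟨?_, ?_, ?_, ?_⟩))
        · exact ha.comp measurable_fst.fst
        · exact hb.comp measurable_fst.fst
        · exact measurable_fst.snd
        · exact measurable_snd
    convert ite hd hshort hlong using 2 with θ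
    rw [findJumps]
    split_ifs <;> rfl

/-- Cutting the interval at length `2 ^ k / T` gives a family of bounded depth. It agrees with the
original one wherever `k = ⌈(b - a) T⌉`, since `k ≤ 2 ^ k`. -/
theorem MeasFam.findJumps (T : ℕ+) (Δ : ℝ) {a b : Θ → ℝ} (ha : Measurable a)
    (hb : Measurable b) : I.MeasFam fun θ => findJumps T Δ (a θ) (b θ) := by
  have hT : (0 : ℝ) < (T : ℕ) := by exact_mod_cast T.pos
  have hc : Measurable fun θ => ⌈(b θ - a θ) * (T : ℕ)⌉₊ :=
    Nat.measurable_ceil.comp ((hb.sub ha).mul_const _)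
  have h := countable_cases (I := I) hc
    (q := fun k θ => BwMJ.findJumps T Δ (a θ) (min (b θ) (a θ + 2 ^ k / (T : ℕ))))
    fun k => findJumps_of_le T Δ k ha (hb.min (ha.add_const _)) fun θ => by
      rw [← le_div_iff₀ hT, sub_le_iff_le_add']
      exact min_le_right _ _
  convert h using 2 with θ
  congr 1
  rw [eq_comm, min_eq_left_iff, ← sub_le_iff_le_add', le_div_iff₀ hT]
  refine (Nat.le_ceil _).trans ?_
  exact_mod_cast Nat.lt_two_pow_self.le

theorem MeasFam.findAllJumps (T : ℕ+) (Δ : ℝ) {Js : Θ → List (ℝ × ℝ)} (hJs : Measurable Js) :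
    I.MeasFam fun θ => findAllJumps T Δ (Js θ) := by
  have key (k : ℕ) : ∀ {Θ : Type} [MeasurableSpace Θ] (x : Fin k → Θ → ℝ × ℝ),
      (∀ i, Measurable (x i)) →
      I.MeasFam fun θ => BwMJ.findAllJumps T Δ (List.ofFn fun i => x i θ) := by
    induction k with
    | zero =>
      intro Θ _ x _
      simp only [List.ofFn_zero]
      exact pure measurable_const
    | succ k ih =>
      intro Θ _ x hx
      simp only [List.ofFn_succ]
      refine bind (MeasFam.findJumps T Δ (hx 0).fst (hx 0).snd) (bind ?_ ?_)
      · exact ih (fun i (q : Θ × List Triplet) => x i.succ q.1) fun i => (hx _).comp measurable_fst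
      · exact pure (measurable_list_append measurable_fst.snd measurable_snd)
  have hJs' := measurable_list_iff.1 hJs
  have h := countable_cases (I := I) hJs'.1
    (q := fun k θ => BwMJ.findAllJumps T Δ (List.ofFn fun i : Fin k => (Js θ).getD i default))
    fun k => key k _ fun i => hJs'.2 i
  convert h using 2 with θ
  congr 1
  apply List.ext_getElem <;> simp

theorem MeasFam.epochs (T : ℕ+) (m j : ℕ) {Js : Θ → List (ℝ × ℝ)} (hJs : Measurable Js) :
    I.MeasFam fun θ => epochs I.ell T m j (Js θ) := by
  induction m generalizing j Θ with
  | zero => exact pure measurable_const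
  | succ m ih =>
    refine bind (MeasFam.findAllJumps T _ hJs) (ih (j + 1) ?_)
    refine measurable_flatMap (fun x hx => ?_) measurable_snd
    exact I.measurable_optimisticShrink T _
      (measurable_optEstimate I.measurable_ell measurable_snd) hx

theorem measurable_action_rjiOS (I : Instance n) (T : ℕ+) (t : ℕ) :
    Measurable fun ω => I.action (rjiOS I.ell T) ω t := by
  have h : I.MeasFam fun _ : Unit => BwMJ.epochs I.ell T T 1 [(0, 1)] :=
    MeasFam.epochs T T 1 (measurable_const (a := [((0 : ℝ), (1 : ℝ))]))
  simp only [rjiOS, action_toPolicy]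
  exact (h.2 0 t).comp (measurable_const (a := ()) |>.prodMk measurable_id)

end Instance

/-! ### The actions played by RJI-OS -/


/-- On a short interval only the right extreme is played, so nothing is asked of its other points;
both halves of a long interval inherit the hypotheses. -/
theorem All.findJumps {P : ℝ → Prop} (T : ℕ+) (Δ : ℝ) {a b : ℝ} (hab : a ≤ b) (hb : P b)
    (h : 1 / (T : ℕ) < b - a → ∀ x ∈ Icc a b, P x) :
    (findJumps T Δ a b).All P fun l =>
      ∀ τ ∈ l, a ≤ τ.α₁ ∧ τ.α₁ ≤ τ.α₂ ∧ τ.α₂ ≤ b := by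
  have hT : (0 : ℝ) < (T : ℕ) := by exact_mod_cast T.pos
  obtain ⟨k, hk⟩ := pow_unbounded_of_one_lt ((b - a) * (T : ℕ)) one_lt_two
  replace hk := hk.le
  induction k generalizing a b with
  | zero =>
    rw [BwMJ.findJumps, dif_pos (by rw [le_div_iff₀ hT]; simpa using hk)]
    refine (Prog.All.estimate hb _).bind fun _ _ => Prog.All.pure ?_
    simp [hab]
  | succ k ih =>
    rw [BwMJ.findJumps]
    split_ifs with hs
    · refine (Prog.All.estimate hb _).bind fun _ _ => Prog.All.pure ?_
      simp [hab]
    · have h' := h (not_le.1 hs)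
      rw [pow_succ] at hk
      refine (Prog.All.estimate (h' a ⟨le_rfl, hab⟩) _).bind fun μ₁ _ =>
        (Prog.All.estimate hb _).bind fun μ₂ _ => ?_
      split_ifs with hg
      · refine (ih (a := a) (b := (a + b) / 2) (by linarith)
          (h' _ ⟨by linarith, by linarith⟩)
          (fun _ x hx => h' x ⟨hx.1, by linarith [hx.2]⟩) (by linarith)).bind fun l hl => ?_
        refine (ih (a := (a + b) / 2) (b := b) (by linarith) hb
          (fun _ x hx => h' x ⟨by linarith [hx.1], hx.2⟩) (by linarith)).bind fun r hr =>
          Prog.All.pure fun τ hτ => ?_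
        rcases List.mem_append.1 hτ with h1 | h1
        · have := hl τ h1
          exact ⟨this.1, this.2.1, by linarith [this.2.2]⟩
        · have := hr τ h1
          exact ⟨by linarith [this.1], this.2.1, this.2.2⟩
      · exact Prog.All.pure (by simp [hab])

theorem All.findAllJumps {P : ℝ → Prop} (T : ℕ+) (Δ : ℝ) {Js : List (ℝ × ℝ)}
    (hJs : ∀ J ∈ Js, 0 ≤ J.1 ∧ J.1 ≤ J.2 ∧ J.2 ≤ 1)
    (h : ∀ J ∈ Js, P J.2 ∧ (1 / (T : ℕ) < J.2 - J.1 → ∀ x ∈ Icc J.1 J.2, P x)) :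
    (findAllJumps T Δ Js).All P fun l =>
      ∀ τ ∈ l, 0 ≤ τ.α₁ ∧ τ.α₁ ≤ τ.α₂ ∧ τ.α₂ ≤ 1 := by
  induction Js with
  | nil => exact Prog.All.pure (by simp)
  | cons J Js ih =>
    simp only [List.forall_mem_cons] at hJs h
    refine (All.findJumps T Δ hJs.1.2.1 h.1.1 h.1.2).bind fun l hl =>
      (ih hJs.2 h.2).bind fun r hr => Prog.All.pure fun τ hτ => ?_
    rcases List.mem_append.1 hτ with h1 | h1
    · have := hl τ h1
      exact ⟨hJs.1.1.trans this.1, this.2.1, this.2.2.trans hJs.1.2.2⟩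
    · exact hr τ h1

namespace Instance

variable {n : ℕ} (I : Instance n)

/-- An interval kept by `Optimistic-Shrink` is the whole interval of the triplet, if this is
short, and otherwise it is the set of good actions. -/
theorem mem_optimisticShrink {T : ℕ+} {Δ opt : ℝ} {τ : Triplet} {J : ℝ × ℝ}
    (h : J ∈ optimisticShrink I.ell T Δ opt τ) :
    (τ.α₂ - τ.α₁ ≤ 1 / (T : ℕ) ∧ opt ≤ I.ell τ.α₂ * τ.μ₂ + Δ / 2 + 1 / (T : ℕ) ∧
      J = (τ.α₁, τ.α₂)) ∨
    (1 / (T : ℕ) < τ.α₂ - τ.α₁ ∧ J.1 ≤ J.2 ∧ Icc J.1 J.2 = shrinkSet I.ell T Δ opt τ) := by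
  rw [optimisticShrink_eq] at h
  split_ifs at h with h1 h2
  · left
    exact ⟨h1.1, h1.2, by simpa using h⟩
  · right
    rw [List.mem_singleton] at h
    subst h
    exact ⟨h2.1, h2.2, (I.shrinkSet_eq _ _ _ _).symm⟩
  · simp at h

theorem optimisticShrink_subset {T : ℕ+} {Δ opt : ℝ} {τ : Triplet} {J : ℝ × ℝ}
    (hτ : τ.α₁ ≤ τ.α₂) (h : J ∈ optimisticShrink I.ell T Δ opt τ) :
    τ.α₁ ≤ J.1 ∧ J.1 ≤ J.2 ∧ J.2 ≤ τ.α₂ := by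
  rcases I.mem_optimisticShrink h with ⟨-, -, rfl⟩ | ⟨-, h1, h2⟩
  · exact ⟨le_rfl, hτ, le_rfl⟩
  · have h3 : J.1 ∈ shrinkSet I.ell T Δ opt τ := h2 ▸ ⟨le_rfl, h1⟩
    have h4 : J.2 ∈ shrinkSet I.ell T Δ opt τ := h2 ▸ ⟨h1, le_rfl⟩
    exact ⟨h3.1.1, h1, h4.1.2⟩

theorem all_epochs (T : ℕ+) (m j : ℕ) {Js : List (ℝ × ℝ)}
    (hJs : ∀ J ∈ Js, 0 ≤ J.1 ∧ J.1 ≤ J.2 ∧ J.2 ≤ 1) :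
    (epochs I.ell T m j Js).All (fun a => a ∈ Icc (0 : ℝ) 1) fun _ => True := by
  induction m generalizing j Js with
  | zero => exact Prog.All.pure trivial
  | succ m ih =>
    refine (All.findAllJumps T _ hJs fun J hJ => ?_).bind fun l hl => ih _ fun J hJ => ?_
    · obtain ⟨h1, h2, h3⟩ := hJs J hJ
      exact ⟨⟨h1.trans h2, h3⟩, fun _ x hx => ⟨h1.trans hx.1, hx.2.trans h3⟩⟩
    · obtain ⟨τ, hτ, hJτ⟩ := List.mem_flatMap.1 hJ
      obtain ⟨h1, h2, h3⟩ := hl τ hτ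
      have h4 := I.optimisticShrink_subset h2 hJτ
      exact ⟨h1.trans h4.1, h4.2.1, h4.2.2.trans h3⟩

variable [NeZero n]

theorem action_rjiOS_mem (T : ℕ+) (ω : ℕ × Fin n → ℝ) (t : ℕ) :
    I.action (rjiOS I.ell T) ω t ∈ Icc (0 : ℝ) 1 := by
  rw [rjiOS, action_toPolicy]
  exact (I.all_epochs T T 1 (Js := [(0, 1)]) (by simp)).act I ω (by simp) 0 t

/-! ### `Find-Jumps` with accurate estimates -/

/-- The number of jumps in `(a, b]`. -/
def numJumps (a b : ℝ) : ℕ := (I.index b : ℕ) - (I.index a : ℕ)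

theorem numJumps_add {a b c : ℝ} (h0 : 0 ≤ a) (hac : a ≤ c) (hcb : c ≤ b) (h1 : b ≤ 1) :
    I.numJumps a c + I.numJumps c b = I.numJumps a b := by
  have h2 : (I.index a : ℕ) ≤ I.index c := I.index_mono h0 hac (hcb.trans h1)
  have h3 : (I.index c : ℕ) ≤ I.index b := I.index_mono (h0.trans hac) hcb h1
  unfold numJumps
  omega

theorem numJumps_le {a b a' b' : ℝ} (h0 : 0 ≤ a) (ha : a ≤ a') (hab : a' ≤ b') (hb : b' ≤ b)
    (h1 : b ≤ 1) : I.numJumps a' b' ≤ I.numJumps a b := by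
  rw [← I.numJumps_add h0 (ha.trans hab) hb h1, ← I.numJumps_add h0 ha hab (hb.trans h1)]
  omega

theorem numJumps_pos {a b : ℝ} (h0 : 0 ≤ a) (hab : a ≤ b) (h1 : b ≤ 1) (h : I.m a < I.m b) :
    1 ≤ I.numJumps a b := by
  have h2 : (I.index a : ℕ) ≤ I.index b := I.index_mono h0 hab h1
  have h3 : (I.index a : ℕ) ≠ I.index b := by
    intro h3
    rw [m, m, Fin.ext h3] at h
    exact lt_irrefl _ h
  unfold numJumps
  omega

theorem numJumps_le_card (a b : ℝ) : I.numJumps a b ≤ n := by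
  have := (I.index b).2
  unfold numJumps
  omega

/-- The empirical mean of the samples of the `i`-th distribution in the rounds
`s, …, s + N - 1`. -/
def avg (ω : ℕ × Fin n → ℝ) (N s : ℕ) (i : Fin n) : ℝ :=
  (∑ t ∈ Finset.range N, ω (s + t, i)) / N

/-- All the empirical means of `N` samples started before time `T` are accurate. -/
def AccurateSamples (ω : ℕ × Fin n → ℝ) (T N : ℕ) (Δ : ℝ) : Prop :=
  ∀ s < T, ∀ i, |avg ω N s i - I.mean i| ≤ Δ / 4

/-- What is known about a triplet computed from accurate estimates. -/
structure AccurateTriplet (T : ℕ) (Δ : ℝ) (τ : Triplet) : Prop where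
  nonneg : 0 ≤ τ.α₁
  le : τ.α₁ ≤ τ.α₂
  le_one : τ.α₂ ≤ 1
  right : |τ.μ₂ - I.m τ.α₂| ≤ Δ / 4
  short : τ.α₂ - τ.α₁ ≤ 1 / T → τ.μ₁ = 0
  long : 1 / T < τ.α₂ - τ.α₁ → |τ.μ₁ - I.m τ.α₁| ≤ Δ / 4 ∧ τ.μ₂ - τ.μ₁ < Δ

variable {I} (ω : ℕ × Fin n → ℝ) {T : ℕ+} {Δ : ℝ}

theorem run_findJumps (I : Instance n) (T : ℕ+) (Δ a b : ℝ) (s : ℕ) :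
    let N := numSamples T Δ
    I.run ω (findJumps T Δ a b) s =
      if b - a ≤ 1 / (T : ℕ) then ([⟨a, b, 0, avg ω N s (I.index b)⟩], s + N)
      else if avg ω N (s + N) (I.index b) - avg ω N s (I.index a) ≥ Δ then
        let L := I.run ω (findJumps T Δ a ((a + b) / 2)) (s + N + N)
        let R := I.run ω (findJumps T Δ ((a + b) / 2) b) L.2
        (L.1 ++ R.1, R.2)
      else ([⟨a, b, avg ω N s (I.index a), avg ω N (s + N) (I.index b)⟩], s + N + N) := by
  intro N
  conv_lhs => rw [findJumps]
  by_cases h : b - a ≤ 1 / (T : ℕ)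
  · simp only [h, dif_pos, if_pos, run_bind, run_estimate, run_pure, avg, N]
  · simp only [h, dif_neg, if_false, not_false_eq_true, run_bind, run_estimate, avg, N]
    split_ifs with h2
    · simp only [run_bind, run_pure]
    · simp only [run_pure]

theorem add_numSamples_le_run_findJumps (I : Instance n) (T : ℕ+) (Δ a b : ℝ) (s : ℕ) :
    s + numSamples T Δ ≤ (I.run ω (findJumps T Δ a b) s).2 := by
  rw [run_findJumps]
  split_ifs
  · exact le_rfl
  · have h1 := I.le_run_snd ω (findJumps T Δ a ((a + b) / 2)) (s + numSamples T Δ + numSamples T Δ)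
    have h2 := I.le_run_snd ω (findJumps T Δ ((a + b) / 2) b)
      (I.run ω (findJumps T Δ a ((a + b) / 2)) (s + numSamples T Δ + numSamples T Δ)).2
    dsimp only
    omega
  · dsimp only
    omega

/-- Two errors of at most `Δ / 4` leave a true gap of at least `Δ / 2`. This is what charges every
split to a jump. -/
theorem numJumps_pos_of_gap (hacc : I.AccurateSamples ω T (numSamples T Δ) Δ) (hΔ : 0 < Δ)
    {a b : ℝ} (h0 : 0 ≤ a) (hab : a ≤ b) (h1 : b ≤ 1) {s s' : ℕ} (hs : s < T) (hs' : s' < T)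
    (h : avg ω (numSamples T Δ) s' (I.index b) - avg ω (numSamples T Δ) s (I.index a) ≥ Δ) :
    1 ≤ I.numJumps a b := by
  apply I.numJumps_pos h0 hab h1
  have h2 := abs_le.1 (hacc s hs (I.index a))
  have h3 := abs_le.1 (hacc s' hs' (I.index b))
  change I.mean (I.index a) < I.mean (I.index b)
  linarith

/-- Before time `T`, `Find-Jumps` spends few rounds on an interval with few jumps. -/
theorem run_findJumps_time_le (hacc : I.AccurateSamples ω T (numSamples T Δ) Δ) (hΔ : 0 < Δ)
    (k : ℕ) {a b : ℝ} (h0 : 0 ≤ a) (hab : a ≤ b) (h1 : b ≤ 1)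
    (hk : (b - a) * (T : ℕ) ≤ 2 ^ k) (s : ℕ) :
    min (I.run ω (findJumps T Δ a b) s).2 T ≤
      min s T + 2 * numSamples T Δ * (1 + 2 * (k * I.numJumps a b)) := by
  have hT : (0 : ℝ) < (T : ℕ) := by exact_mod_cast T.pos
  have hN : 2 * numSamples T Δ ≤ 2 * numSamples T Δ * (1 + 2 * (k * I.numJumps a b)) :=
    Nat.le_mul_of_pos_right _ (by omega)
  induction k generalizing a b s with
  | zero =>
    rw [run_findJumps, if_pos (by rw [le_div_iff₀ hT]; simpa using hk)]
    dsimp only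
    omega
  | succ k ih =>
    -- If the horizon is reached within the first two estimates, truncation at `T` gives the bound;
    -- otherwise both windows start before `T` and are accurate.
    by_cases hlate : (T : ℕ) ≤ s + numSamples T Δ + numSamples T Δ
    · omega
    rw [run_findJumps]
    split_ifs with hs hg
    · dsimp only
      omega
    · have hJ := numJumps_pos_of_gap ω hacc hΔ h0 hab h1 (by omega) (by omega) hg
      rw [pow_succ] at hk
      have hadd := I.numJumps_add h0 (c := (a + b) / 2) (by linarith) (by linarith) h1
      have hL := ih (a := a) (b := (a + b) / 2) h0 (by linarith) (by linarith) (by linarith)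
        (s + numSamples T Δ + numSamples T Δ) (Nat.le_mul_of_pos_right _ (by omega))
      have hR := ih (a := (a + b) / 2) (b := b) (by linarith) (by linarith) h1 (by linarith)
        (I.run ω (findJumps T Δ a ((a + b) / 2)) (s + numSamples T Δ + numSamples T Δ)).2
        (Nat.le_mul_of_pos_right _ (by omega))
      dsimp only
      rw [← hadd] at hJ ⊢
      refine hR.trans ((Nat.add_le_add_right hL _).trans ?_)
      have e : min (s + numSamples T Δ + numSamples T Δ) (T : ℕ) ≤
          min s T + 2 * numSamples T Δ := by omega
      refine (Nat.add_le_add_right (Nat.add_le_add_right e _) _).trans ?_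
      -- In units of `2 N`, the two halves and the root account for `3 + 2 k J`, which is at most `1
      -- + 2 (k + 1) J` because `J ≥ 1`.
      nlinarith [Nat.mul_le_mul_left (4 * numSamples T Δ) hJ]
    · dsimp only
      omega

/-- The triplets returned by `Find-Jumps` before time `T`. -/
theorem run_findJumps_spec (hacc : I.AccurateSamples ω T (numSamples T Δ) Δ) (hΔ : 0 < Δ)
    (k : ℕ) {a b : ℝ} (h0 : 0 ≤ a) (hab : a ≤ b) (h1 : b ≤ 1)
    (hk : (b - a) * (T : ℕ) ≤ 2 ^ k) (s : ℕ)
    (hs : s < T) (hend : (I.run ω (findJumps T Δ a b) s).2 < T) :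
    let l := (I.run ω (findJumps T Δ a b) s).1
    (∀ τ ∈ l, I.AccurateTriplet T Δ τ) ∧ l.length ≤ 1 + k * I.numJumps a b ∧
      (l.map fun τ => I.numJumps τ.α₁ τ.α₂).sum ≤ I.numJumps a b ∧
      ∀ x ∈ Icc a b, ∃ τ ∈ l, x ∈ Icc τ.α₁ τ.α₂ := by
  have hT : (0 : ℝ) < (T : ℕ) := by exact_mod_cast T.pos
  have hshort (hd : b - a ≤ 1 / (T : ℕ)) :
      I.AccurateTriplet T Δ ⟨a, b, 0, avg ω (numSamples T Δ) s (I.index b)⟩ :=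
    ⟨h0, hab, h1, hacc s hs _, fun _ => rfl, fun h => absurd hd (not_le.2 h)⟩
  induction k generalizing a b s with
  | zero =>
    have hd : b - a ≤ 1 / (T : ℕ) := by rw [le_div_iff₀ hT]; simpa using hk
    rw [run_findJumps, if_pos hd]
    simpa using hshort hd
  | succ k ih =>
    rw [run_findJumps] at hend ⊢
    split_ifs at hend ⊢ with hd hg
    · simpa using hshort hd
    · dsimp only at hend ⊢
      set L := I.run ω (findJumps T Δ a ((a + b) / 2)) (s + numSamples T Δ + numSamples T Δ)
        with hLdef
      set R := I.run ω (findJumps T Δ ((a + b) / 2) b) L.2 with hRdef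
      have hLs : s + numSamples T Δ + numSamples T Δ ≤ L.2 := I.le_run_snd ω _ _
      have hRs : L.2 ≤ R.2 := I.le_run_snd ω _ _
      have hJ := numJumps_pos_of_gap ω hacc hΔ h0 hab h1 hs (by omega) hg
      rw [pow_succ] at hk
      have hadd := I.numJumps_add h0 (c := (a + b) / 2) (by linarith) (by linarith) h1
      obtain ⟨l1, l2, l3, l4⟩ := ih (a := a) (b := (a + b) / 2) h0 (by linarith) (by linarith)
        (by linarith) (s + numSamples T Δ + numSamples T Δ) (by omega) (hRs.trans_lt hend)
        fun hd => ⟨h0, by dsimp only; linarith, by dsimp only; linarith, hacc _ (by omega) _,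
          fun _ => rfl, fun h => absurd hd (not_le.2 h)⟩
      obtain ⟨r1, r2, r3, r4⟩ := ih (a := (a + b) / 2) (b := b) (by linarith) (by linarith) h1
        (by linarith) L.2 (by omega) hend
        fun hd => ⟨by dsimp only; linarith, by dsimp only; linarith, h1, hacc _ (by omega) _,
          fun _ => rfl, fun h => absurd hd (not_le.2 h)⟩
      refine ⟨?_, ?_, ?_, ?_⟩
      · intro τ hτ
        exact (List.mem_append.1 hτ).elim (l1 τ) (r1 τ)
      · rw [List.length_append]
        refine (Nat.add_le_add l2 r2).trans ?_
        rw [← hadd] at hJ ⊢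
        -- The additional `1` from having two halves is paid for by `J ≥ 1`.
        nlinarith
      · rw [List.map_append, List.sum_append, ← hadd]
        exact Nat.add_le_add l3 r3
      · intro x hx
        rcases le_total x ((a + b) / 2) with h | h
        · obtain ⟨τ, hτ, hx'⟩ := l4 x ⟨hx.1, h⟩
          exact ⟨τ, List.mem_append_left _ hτ, hx'⟩
        · obtain ⟨τ, hτ, hx'⟩ := r4 x ⟨h, hx.2⟩
          exact ⟨τ, List.mem_append_right _ hτ, hx'⟩
    · dsimp only at hend
      have : I.AccurateTriplet T Δ ⟨a, b, avg ω (numSamples T Δ) s (I.index a),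
          avg ω (numSamples T Δ) (s + numSamples T Δ) (I.index b)⟩ :=
        ⟨h0, hab, h1, hacc _ (by omega) _, fun h => absurd h hd,
          fun _ => ⟨hacc s hs _, not_le.1 hg⟩⟩
      simpa using this

/-- The total number of jumps in a collection of intervals. -/
def totalJumps (I : Instance n) (Js : List (ℝ × ℝ)) : ℕ :=
  (Js.map fun J => I.numJumps J.1 J.2).sum

theorem mul_le_two_pow {k : ℕ} (hk : (T : ℕ) ≤ 2 ^ k) {a b : ℝ} (h0 : 0 ≤ a) (h1 : b ≤ 1) :
    (b - a) * (T : ℕ) ≤ 2 ^ k := by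
  have h2 : ((T : ℕ) : ℝ) ≤ 2 ^ k := by exact_mod_cast hk
  have hT : (0 : ℝ) < (T : ℕ) := by exact_mod_cast T.pos
  nlinarith

theorem run_findAllJumps_time_le (hacc : I.AccurateSamples ω T (numSamples T Δ) Δ) (hΔ : 0 < Δ)
    {k : ℕ} (hk : (T : ℕ) ≤ 2 ^ k) {Js : List (ℝ × ℝ)}
    (hJs : ∀ J ∈ Js, 0 ≤ J.1 ∧ J.1 ≤ J.2 ∧ J.2 ≤ 1) (s : ℕ) :
    min (I.run ω (findAllJumps T Δ Js) s).2 T ≤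
      min s T + 2 * numSamples T Δ * (Js.length + 2 * (k * I.totalJumps Js)) := by
  induction Js generalizing s with
  | nil => simp [findAllJumps]
  | cons J Js ih =>
    simp only [List.forall_mem_cons] at hJs
    simp only [findAllJumps, run_bind, run_pure]
    have h1 := run_findJumps_time_le ω hacc hΔ k hJs.1.1 hJs.1.2.1 hJs.1.2.2
      (mul_le_two_pow hk hJs.1.1 hJs.1.2.2) s
    have h2 := ih hJs.2 (I.run ω (findJumps T Δ J.1 J.2) s).2
    refine h2.trans ((Nat.add_le_add_right h1 _).trans (le_of_eq ?_))
    simp only [List.length_cons, totalJumps, List.map_cons, List.sum_cons]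
    ring

theorem add_numSamples_le_run_findAllJumps (I : Instance n) (T : ℕ+) (Δ : ℝ)
    {Js : List (ℝ × ℝ)} (hJs : Js ≠ []) (s : ℕ) :
    s + numSamples T Δ ≤ (I.run ω (findAllJumps T Δ Js) s).2 := by
  obtain ⟨J, Js, rfl⟩ := List.exists_cons_of_ne_nil hJs
  simp only [findAllJumps, run_bind, run_pure]
  exact (I.add_numSamples_le_run_findJumps ω T Δ J.1 J.2 s).trans (I.le_run_snd ω _ _)

theorem run_findAllJumps_spec (hacc : I.AccurateSamples ω T (numSamples T Δ) Δ) (hΔ : 0 < Δ)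
    {k : ℕ} (hk : (T : ℕ) ≤ 2 ^ k) {Js : List (ℝ × ℝ)}
    (hJs : ∀ J ∈ Js, 0 ≤ J.1 ∧ J.1 ≤ J.2 ∧ J.2 ≤ 1) (s : ℕ)
    (hend : (I.run ω (findAllJumps T Δ Js) s).2 < T) :
    let l := (I.run ω (findAllJumps T Δ Js) s).1
    (∀ τ ∈ l, I.AccurateTriplet T Δ τ) ∧ l.length ≤ Js.length + k * I.totalJumps Js ∧
      (l.map fun τ => I.numJumps τ.α₁ τ.α₂).sum ≤ I.totalJumps Js ∧
      ∀ J ∈ Js, ∀ x ∈ Icc J.1 J.2, ∃ τ ∈ l, x ∈ Icc τ.α₁ τ.α₂ := by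
  induction Js generalizing s with
  | nil => simp [findAllJumps]
  | cons J Js ih =>
    simp only [List.forall_mem_cons] at hJs
    simp only [findAllJumps, run_bind, run_pure] at hend ⊢
    have h1 := I.le_run_snd ω (findJumps T Δ J.1 J.2) s
    have h2 := I.le_run_snd ω (findAllJumps T Δ Js) (I.run ω (findJumps T Δ J.1 J.2) s).2
    obtain ⟨l1, l2, l3, l4⟩ := run_findJumps_spec ω hacc hΔ k hJs.1.1 hJs.1.2.1 hJs.1.2.2
      (mul_le_two_pow hk hJs.1.1 hJs.1.2.2) s (by omega) (by omega)
    obtain ⟨r1, r2, r3, r4⟩ := ih hJs.2 (I.run ω (findJumps T Δ J.1 J.2) s).2 hend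
    simp only [totalJumps, List.map_cons, List.sum_cons, List.length_cons] at r2 r3 ⊢
    refine ⟨?_, ?_, ?_, ?_⟩
    · intro τ hτ
      exact (List.mem_append.1 hτ).elim (l1 τ) (r1 τ)
    · rw [List.length_append]
      refine (Nat.add_le_add l2 r2).trans (le_of_eq ?_)
      ring
    · rw [List.map_append, List.sum_append]
      exact Nat.add_le_add l3 r3
    · rw [List.forall_mem_cons]
      constructor
      · intro x hx
        obtain ⟨τ, hτ, hx'⟩ := l4 x hx
        exact ⟨τ, List.mem_append_left _ hτ, hx'⟩
      · intro K hK x hx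
        obtain ⟨τ, hτ, hx'⟩ := r4 K hK x hx
        exact ⟨τ, List.mem_append_right _ hτ, hx'⟩

end Instance

/-! ### One epoch with accurate estimates -/

theorem foldl_max_le_iff {X : Type*} (f g : X → ℝ) (l : List X) (o B : ℝ) :
    l.foldl (fun o τ => max (max o (f τ)) (g τ)) o ≤ B ↔
      o ≤ B ∧ ∀ τ ∈ l, f τ ≤ B ∧ g τ ≤ B := by
  induction l generalizing o with
  | nil => simp
  | cons τ l ih =>
    rw [List.foldl_cons, ih, List.forall_mem_cons, max_le_iff, max_le_iff]
    tauto

theorem optEstimate_le_iff {ell : ℝ → ℝ} {l : List Triplet} {B : ℝ} :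
    optEstimate ell l ≤ B ↔ 0 ≤ B ∧ ∀ τ ∈ l, ell τ.α₁ * τ.μ₁ ≤ B ∧ ell τ.α₂ * τ.μ₂ ≤ B :=
  foldl_max_le_iff (fun τ : Triplet => ell τ.α₁ * τ.μ₁) (fun τ => ell τ.α₂ * τ.μ₂) l 0 B

namespace Instance

variable {n : ℕ} {I : Instance n} {T : ℕ+} {Δ : ℝ}

theorem ell_mul_le {α x y c : ℝ} (hα : α ∈ Icc (0 : ℝ) 1) (hc : 0 ≤ c) (h : x ≤ y + c) :
    I.ell α * x ≤ I.ell α * y + c := by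
  have h1 := I.ell_mapsTo hα
  nlinarith [mul_le_mul_of_nonneg_left h h1.1, mul_le_of_le_one_left hc h1.2]

theorem length_flatMap_optimisticShrink_le (opt : ℝ) (l : List Triplet) :
    (l.flatMap (optimisticShrink I.ell T Δ opt)).length ≤ l.length := by
  induction l with
  | nil => simp
  | cons τ l ih =>
    have : (optimisticShrink I.ell T Δ opt τ).length ≤ 1 := by
      unfold optimisticShrink
      split_ifs <;> simp
    rw [List.flatMap_cons, List.length_append, List.length_cons]
    omega

variable [NeZero n]

namespace AccurateTriplet

variable {τ : Triplet}

theorem left_mem (h : I.AccurateTriplet T Δ τ) : τ.α₁ ∈ Icc (0 : ℝ) 1 :=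
  ⟨h.nonneg, h.le.trans h.le_one⟩

theorem right_mem (h : I.AccurateTriplet T Δ τ) : τ.α₂ ∈ Icc (0 : ℝ) 1 :=
  ⟨h.nonneg.trans h.le, h.le_one⟩

theorem reward_right_le (h : I.AccurateTriplet T Δ τ) (hΔ : 0 < Δ) :
    I.ell τ.α₂ * τ.μ₂ ≤ I.OPT + Δ / 4 := by
  have h1 := (abs_le.1 h.right).2
  have h2 := I.ell_mul_le h.right_mem (x := τ.μ₂) (y := I.m τ.α₂) (c := Δ / 4) (by linarith)
    (by linarith)
  have h3 := I.u_le_OPT h.right_mem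
  rw [u_eq] at h3
  linarith

theorem reward_left_le (h : I.AccurateTriplet T Δ τ) (hΔ : 0 < Δ) :
    I.ell τ.α₁ * τ.μ₁ ≤ I.OPT + Δ / 4 := by
  rcases le_or_gt (τ.α₂ - τ.α₁) (1 / (T : ℕ)) with hs | hs
  · rw [h.short hs, mul_zero]
    linarith [I.OPT_mem.1]
  · have h1 := (abs_le.1 (h.long hs).1).2
    have h2 := I.ell_mul_le h.left_mem (x := τ.μ₁) (y := I.m τ.α₁) (c := Δ / 4) (by linarith)
      (by linarith)
    have h3 := I.u_le_OPT h.left_mem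
    rw [u_eq] at h3
    linarith

/-- On a short interval, the estimate at the right extreme controls all the rewards. -/
theorem u_le_of_short (h : I.AccurateTriplet T Δ τ) (hΔ : 0 < Δ)
    (hs : τ.α₂ - τ.α₁ ≤ 1 / (T : ℕ)) {α : ℝ} (hα : α ∈ Icc τ.α₁ τ.α₂) :
    I.u α ≤ I.ell τ.α₂ * τ.μ₂ + Δ / 4 + 1 / (T : ℕ) := by
  have hα' : α ∈ Icc (0 : ℝ) 1 := ⟨h.nonneg.trans hα.1, hα.2.trans h.le_one⟩
  have h1 : I.m α ≤ I.m τ.α₂ := I.m_mono hα'.1 hα.2 h.le_one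
  have h2 := I.ell_le_add hα.2
  have h3 := I.m_mem τ.α₂
  have h4 := I.ell_mapsTo hα'
  have h5 := (abs_le.1 h.right).1
  have h6 := I.ell_mul_le h.right_mem (x := I.m τ.α₂) (y := τ.μ₂) (c := Δ / 4) (by linarith)
    (by linarith)
  have h7 : I.ell α * I.m α ≤ I.ell α * I.m τ.α₂ := mul_le_mul_of_nonneg_left h1 h4.1
  -- Moving `ell` from `α` to the right extreme loses at most `1 / T`, as the mean is at most `1`.
  have h8 : τ.α₂ - α ≤ 1 / (T : ℕ) := by linarith [hα.1]
  have h9 : 0 ≤ τ.α₂ - α := by linarith [hα.2]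
  rw [u_eq]
  nlinarith [h3.1, h3.2]

/-- On a long interval, the estimate at the left extreme controls the rewards. -/
theorem u_le_of_long (h : I.AccurateTriplet T Δ τ) (hΔ : 0 < Δ)
    (hs : 1 / (T : ℕ) < τ.α₂ - τ.α₁) {α : ℝ} (hα : α ∈ Icc τ.α₁ τ.α₂) :
    I.u α ≤ I.ell α * τ.μ₁ + 5 * Δ / 4 ∧ I.u α ≤ I.ell τ.α₁ * τ.μ₁ + 5 * Δ / 4 := by
  have hα' : α ∈ Icc (0 : ℝ) 1 := ⟨h.nonneg.trans hα.1, hα.2.trans h.le_one⟩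
  have h1 : I.m α ≤ I.m τ.α₂ := I.m_mono hα'.1 hα.2 h.le_one
  have h2 := (abs_le.1 h.right).1
  -- The interval was not split, so with the error at the right extreme every mean on it is at most
  -- `τ.μ₁ + Δ + Δ / 4`.
  have h3 := (h.long hs).2
  constructor
  · rw [u_eq]
    exact I.ell_mul_le hα' (by linarith) (by linarith)
  · have h4 := I.ell_mul_le h.left_mem (x := I.m α) (y := τ.μ₁) (c := 5 * Δ / 4) (by linarith)
      (by linarith)
    have h5 := mul_le_mul_of_nonneg_right (I.ell_anti hα.1) (I.m_mem α).1
    rw [u_eq]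
    linarith

end AccurateTriplet

theorem optEstimate_le_OPT {l : List Triplet} (hl : ∀ τ ∈ l, I.AccurateTriplet T Δ τ)
    (hΔ : 0 < Δ) : optEstimate I.ell l ≤ I.OPT + Δ / 4 :=
  optEstimate_le_iff.2 ⟨by linarith [I.OPT_mem.1], fun τ hτ =>
    ⟨(hl τ hτ).reward_left_le hΔ, (hl τ hτ).reward_right_le hΔ⟩⟩

/-- The triplet covering an optimal action already has a large estimated reward: at its right
extreme if short, at its left extreme if long. -/
theorem OPT_le_optEstimate {l : List Triplet} (hl : ∀ τ ∈ l, I.AccurateTriplet T Δ τ)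
    (hΔ : 0 < Δ) {α : ℝ} (hα : I.u α = I.OPT) (hcov : ∃ τ ∈ l, α ∈ Icc τ.α₁ τ.α₂) :
    I.OPT ≤ optEstimate I.ell l + 5 * Δ / 4 + 1 / (T : ℕ) := by
  obtain ⟨τ, hτ, hατ⟩ := hcov
  obtain ⟨h1, h2⟩ := (optEstimate_le_iff.1 (le_refl (optEstimate I.ell l))).2 τ hτ
  have hT : (0 : ℝ) ≤ 1 / (T : ℕ) := by positivity
  rcases le_or_gt (τ.α₂ - τ.α₁) (1 / (T : ℕ)) with hs | hs
  · have := (hl τ hτ).u_le_of_short hΔ hs hατ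
    linarith
  · have := ((hl τ hτ).u_le_of_long hΔ hs hατ).2
    linarith

/-- The collection of intervals `Js` is sound at level `g`: every action that can be played by
`Find-Jumps` has regret at most `g`, and the collection contains an optimal action. -/
structure Sound (I : Instance n) (T : ℕ) (g α : ℝ) (Js : List (ℝ × ℝ)) : Prop where
  valid : ∀ J ∈ Js, 0 ≤ J.1 ∧ J.1 ≤ J.2 ∧ J.2 ≤ 1
  gap : ∀ J ∈ Js, I.OPT - I.u J.2 ≤ g ∧
    (1 / T < J.2 - J.1 → ∀ x ∈ Icc J.1 J.2, I.OPT - I.u x ≤ g)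
  cover : ∃ J ∈ Js, α ∈ Icc J.1 J.2

/-- `Optimistic-Shrink` keeps an optimal action, and discards the actions of large regret. -/
theorem sound_flatMap {l : List Triplet} (hl : ∀ τ ∈ l, I.AccurateTriplet T Δ τ) (hΔ : 0 < Δ)
    {α : ℝ} (hα : I.u α = I.OPT) (hcov : ∃ τ ∈ l, α ∈ Icc τ.α₁ τ.α₂) :
    I.Sound T (4 * Δ + 3 / (T : ℕ)) α
      (l.flatMap (optimisticShrink I.ell T Δ (optEstimate I.ell l))) := by
  have hup := optEstimate_le_OPT hl hΔ
  have hlo := OPT_le_optEstimate hl hΔ hα hcov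
  set opt := optEstimate I.ell l
  have hT : (0 : ℝ) ≤ 1 / (T : ℕ) := by positivity
  have hT2 : (2 : ℝ) / (T : ℕ) = 2 * (1 / (T : ℕ)) := by ring
  have hT3 : (3 : ℝ) / (T : ℕ) = 3 * (1 / (T : ℕ)) := by ring
  refine ⟨fun J hJ => ?_, fun J hJ => ?_, ?_⟩
  · obtain ⟨τ, hτ, hJτ⟩ := List.mem_flatMap.1 hJ
    have h := hl τ hτ
    have h4 := I.optimisticShrink_subset h.le hJτ
    exact ⟨h.nonneg.trans h4.1, h4.2.1, h4.2.2.trans h.le_one⟩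
  · obtain ⟨τ, hτ, hJτ⟩ := List.mem_flatMap.1 hJ
    have h := hl τ hτ
    rcases I.mem_optimisticShrink hJτ with ⟨h1, h2, rfl⟩ | ⟨h1, h2, h3⟩
    -- Short case: the losses are `Δ/2 + 1/T` from the test, `5Δ/4 + 1/T` from `opt` and `Δ/4` from
    -- the estimate.
    · refine ⟨?_, fun h' => absurd h1 (not_le.2 h')⟩
      have h3 := (abs_le.1 h.right).2
      have h4 := I.ell_mul_le h.right_mem (x := τ.μ₂) (y := I.m τ.α₂) (c := Δ / 4)
        (by linarith) (by linarith)
      rw [u_eq]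
      dsimp only
      linarith
    -- Long case: `2Δ + 2/T` from the test, `5Δ/4 + 1/T` from `opt` and `Δ/4` from the estimate, in
    -- total `7Δ/2 + 3/T`. The mean at `x` is at least the one at the left extreme.
    · have key : ∀ x ∈ Icc J.1 J.2, I.OPT - I.u x ≤ 4 * Δ + 3 / (T : ℕ) := by
        intro x hx
        rw [h3] at hx
        have hx' : x ∈ Icc (0 : ℝ) 1 := ⟨h.nonneg.trans hx.1.1, hx.1.2.trans h.le_one⟩
        have h4 := hx.2
        have h5 := (abs_le.1 (h.long h1).1).2
        have h6 := I.m_mono h.nonneg hx.1.1 hx'.2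
        have h7 := I.ell_mul_le hx' (x := τ.μ₁) (y := I.m x) (c := Δ / 4)
          (by linarith) (by linarith)
        rw [u_eq]
        linarith
      exact ⟨key _ ⟨h2, le_rfl⟩, fun _ => key⟩
  · obtain ⟨τ, hτ, hατ⟩ := hcov
    have h := hl τ hτ
    rcases le_or_gt (τ.α₂ - τ.α₁) (1 / (T : ℕ)) with hs | hs
    · refine ⟨(τ.α₁, τ.α₂), List.mem_flatMap.2 ⟨τ, hτ, ?_⟩, hατ⟩
      have h1 := h.u_le_of_short hΔ hs hατ
      -- The slack `Δ / 2` of the test is exactly the error `Δ / 4` of the estimate plus the excess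
      -- `Δ / 4` of `opt` over the optimum.
      rw [optimisticShrink_eq, if_pos ⟨hs, by linarith⟩]
      simp
    · have h1 := (h.u_le_of_long hΔ hs hατ).1
      have h2 : α ∈ shrinkSet I.ell T Δ opt τ := ⟨hατ, by linarith⟩
      rw [shrinkSet_eq] at h2
      refine ⟨(I.shrinkLeft T Δ opt τ, I.shrinkRight T Δ opt τ),
        List.mem_flatMap.2 ⟨τ, hτ, ?_⟩, h2⟩
      rw [optimisticShrink_eq, if_neg (fun h' => absurd h'.1 (not_le.2 hs)),
        if_pos ⟨hs, h2.1.trans h2.2⟩]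
      simp

theorem totalJumps_flatMap_optimisticShrink_le (opt : ℝ) {l : List Triplet}
    (hl : ∀ τ ∈ l, I.AccurateTriplet T Δ τ) :
    I.totalJumps (l.flatMap (optimisticShrink I.ell T Δ opt)) ≤
      (l.map fun τ => I.numJumps τ.α₁ τ.α₂).sum := by
  induction l with
  | nil => simp [totalJumps]
  | cons τ l ih =>
    rw [List.forall_mem_cons] at hl
    have h1 : ((optimisticShrink I.ell T Δ opt τ).map fun J => I.numJumps J.1 J.2).sum ≤
        I.numJumps τ.α₁ τ.α₂ := by
      have h2 : ∀ J ∈ optimisticShrink I.ell T Δ opt τ,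
          I.numJumps J.1 J.2 ≤ I.numJumps τ.α₁ τ.α₂ := fun J hJ => by
        have h3 := I.optimisticShrink_subset hl.1.le hJ
        exact I.numJumps_le hl.1.nonneg h3.1 h3.2.1 h3.2.2 hl.1.le_one
      rw [optimisticShrink_eq] at h2 ⊢
      split_ifs at h2 ⊢ with c1 c2
      · simp
      · simpa using h2
      · simp
    have h2 := ih hl.2
    unfold totalJumps at h2 ⊢
    rw [List.flatMap_cons, List.map_append, List.sum_append, List.map_cons, List.sum_cons]
    omega

/-! ### The number of samples -/

theorem numSamples_eq (T : ℕ+) (j : ℕ) :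
    numSamples T (1 / 2 ^ j) = ⌈8 * (4 : ℝ) ^ j * Real.log (4 * (T : ℕ) ^ 2)⌉₊ := by
  have hT : ((T : ℕ) : ℝ) ≠ 0 := by exact_mod_cast T.ne_zero
  have h4 : (4 : ℝ) ^ j = (2 ^ j) ^ 2 := by rw [← pow_mul, mul_comm, pow_mul]; norm_num
  unfold numSamples
  rw [h4]
  field_simp

theorem one_le_log_four_mul_sq (T : ℕ+) : 1 ≤ Real.log (4 * ((T : ℕ) : ℝ) ^ 2) := by
  have hT : (1 : ℝ) ≤ (T : ℕ) := by exact_mod_cast T.pos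
  rw [Real.le_log_iff_exp_le (by positivity)]
  have := Real.exp_one_lt_d9
  nlinarith

theorem le_numSamples (T : ℕ+) (j : ℕ) :
    8 * (4 : ℝ) ^ j * Real.log (4 * (T : ℕ) ^ 2) ≤ numSamples T (1 / 2 ^ j) := by
  rw [numSamples_eq]
  exact Nat.le_ceil _

/-- Crude, but it makes the starting times of the epochs grow geometrically, so that only
logarithmically many start before `T`. -/
theorem two_pow_le_numSamples (T : ℕ+) (j : ℕ) : 2 ^ j ≤ numSamples T (1 / 2 ^ j) := by
  have h1 := le_numSamples T j
  have h2 := one_le_log_four_mul_sq T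
  have h3 : (2 : ℝ) ^ j ≤ 4 ^ j := by gcongr; norm_num
  have h4 : (0 : ℝ) < 4 ^ j := by positivity
  have h5 : (2 : ℝ) ^ j ≤ numSamples T (1 / 2 ^ j) := by nlinarith
  exact_mod_cast h5

theorem numSamples_le {T : ℕ+} (hT : 2 ≤ (T : ℕ)) (j : ℕ) :
    (numSamples T (1 / 2 ^ j) : ℝ) ≤ 34 * 4 ^ j * Real.log (T : ℕ) := by
  have hT' : (2 : ℝ) ≤ (T : ℕ) := by exact_mod_cast hT
  have hlog : Real.log 2 ≤ Real.log (T : ℕ) := Real.log_le_log (by norm_num) hT'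
  have hl2 := Real.log_two_gt_d9
  have h1 := one_le_log_four_mul_sq T
  have h4 : (1 : ℝ) ≤ 4 ^ j := one_le_pow₀ (by norm_num)
  have h2 : Real.log (4 * ((T : ℕ) : ℝ) ^ 2) ≤ 4 * Real.log (T : ℕ) := by
    rw [Real.log_mul (by norm_num) (by positivity), Real.log_pow,
      show (4 : ℝ) = 2 ^ 2 by norm_num, Real.log_pow]
    push_cast
    linarith
  rw [numSamples_eq]
  have h3 := (Nat.ceil_lt_add_one (a := 8 * (4 : ℝ) ^ j * Real.log (4 * (T : ℕ) ^ 2))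
    (by positivity)).le
  have h5 := mul_le_mul_of_nonneg_left h2 (show (0 : ℝ) ≤ 8 * 4 ^ j by positivity)
  -- Absorbs the rounding up; the constant is `34 = 8 * 4 + 2`.
  have h6 : 1 ≤ 2 * (4 : ℝ) ^ j * Real.log (T : ℕ) := by nlinarith
  linarith

/-! ### The regret of RJI-OS with accurate estimates -/

/-- The bound for the regret of epoch `j` as long as `1 / 2 ^ j` exceeds the threshold `ε`. -/
def epochBound (n : ℕ) (T : ℕ+) (d : ℕ) (ε : ℝ) (j : ℕ) : ℝ :=
  if ε < 1 / 2 ^ j then 48 * d ^ 2 * n * numSamples T (1 / 2 ^ j) * (1 / 2 ^ j) else 0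

theorem epochBound_nonneg (n : ℕ) (T : ℕ+) (d : ℕ) (ε : ℝ) (j : ℕ) :
    0 ≤ epochBound n T d ε j := by
  unfold epochBound
  split_ifs <;> positivity

/-- Above the threshold, the part `8Δ` of the regret per round is multiplied by the duration `2 N *
3 d² n`, whence the factor `48`. Below it, `8Δ ≤ 8ε` is charged to the rounds, as is `3 / T` in both
cases. -/
theorem cost_findAllJumps_le {ω : ℕ × Fin n → ℝ} {d j : ℕ} (hjd : j < d)
    (hTd : (T : ℕ) ≤ 2 ^ d) {ε : ℝ} (hε : 0 ≤ ε)
    (hacc : I.AccurateSamples ω T (numSamples T (1 / 2 ^ j)) (1 / 2 ^ j)) {α : ℝ}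
    {Js : List (ℝ × ℝ)} (hJs : I.Sound T (8 * (1 / 2 ^ j) + 3 / (T : ℕ)) α Js)
    (hjumps : I.totalJumps Js ≤ n) (hlen : Js.length ≤ j * (d * n)) (s : ℕ) :
    I.cost ω T (findAllJumps T (1 / 2 ^ j) Js) s ≤ epochBound n T d ε j +
      (8 * ε + 3 / (T : ℕ)) *
        ((min (I.run ω (findAllJumps T (1 / 2 ^ j) Js) s).2 T : ℕ) - (min s T : ℕ) : ℝ) := by
  have h1 := (All.findAllJumps T (1 / 2 ^ j) hJs.valid hJs.gap).cost_le I ω T s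
  have h2 := run_findAllJumps_time_le ω hacc (by positivity) hTd hJs.valid s
  have h3 : min s T ≤ min (I.run ω (findAllJumps T (1 / 2 ^ j) Js) s).2 T :=
    min_le_min_right _ (I.le_run_snd ω _ _)
  generalize min (I.run ω (findAllJumps T (1 / 2 ^ j) Js) s).2 T = e at h1 h2 h3 ⊢
  generalize min s T = s' at h1 h2 h3 ⊢
  have h3' : (s' : ℝ) ≤ e := by exact_mod_cast h3
  refine h1.trans ?_
  unfold epochBound
  split_ifs with hcase
  · have h4 : Js.length + 2 * (d * I.totalJumps Js) ≤ 3 * d ^ 2 * n := by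
      have a1 : Js.length ≤ d ^ 2 * n := by
        refine hlen.trans ?_
        rw [pow_two, mul_assoc]
        exact Nat.mul_le_mul_right _ hjd.le
      have a2 : d * I.totalJumps Js ≤ d * n := Nat.mul_le_mul_left _ hjumps
      have a3 : d * n ≤ d ^ 2 * n := Nat.mul_le_mul_right _ (Nat.le_self_pow two_ne_zero _)
      linarith
    have h5 : e ≤ s' + 2 * numSamples T (1 / 2 ^ j) * (3 * d ^ 2 * n) :=
      h2.trans (Nat.add_le_add_left (Nat.mul_le_mul_left _ h4) _)
    have h5' : (e : ℝ) ≤ s' + 2 * numSamples T (1 / 2 ^ j) * (3 * d ^ 2 * n) := by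
      exact_mod_cast h5
    have h6 : (0 : ℝ) < 1 / 2 ^ j := by positivity
    have h7 : 8 * (1 / 2 ^ j) * ((e : ℝ) - s') ≤
        8 * (1 / 2 ^ j) * (2 * numSamples T (1 / 2 ^ j) * (3 * d ^ 2 * n)) := by
      apply mul_le_mul_of_nonneg_left _ (by positivity)
      linarith
    have h8 : 0 ≤ 8 * ε * ((e : ℝ) - s') := by
      apply mul_nonneg (by positivity)
      linarith
    nlinarith
  · have h4 := not_lt.1 hcase
    rw [zero_add]
    apply mul_le_mul_of_nonneg_right _ (by linarith)
    linarith

/-- The invariant `2 ^ j ≤ 2 + s` holds because the earlier epochs took at least `2 + 4 + ⋯ + 2 ^ (j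
- 1)` rounds. While `s < T` it forces `j < d`, so accuracy is needed in the first epochs only. -/
theorem cost_epochs_le {ω : ℕ × Fin n → ℝ} {d : ℕ} (hTd : (T : ℕ) + 1 < 2 ^ d) {ε : ℝ}
    (hε : 0 ≤ ε)
    (hacc : ∀ j, 1 ≤ j → j < d →
      I.AccurateSamples ω T (numSamples T (1 / 2 ^ j)) (1 / 2 ^ j)) {α : ℝ}
    (hα : I.u α = I.OPT) (k : ℕ) {j : ℕ} (hj : 1 ≤ j) {Js : List (ℝ × ℝ)}
    (hJs : I.Sound T (8 * (1 / 2 ^ j) + 3 / (T : ℕ)) α Js)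
    (hjumps : I.totalJumps Js ≤ n) (hlen : Js.length ≤ j * (d * n)) {s : ℕ}
    (hs : 2 ^ j ≤ 2 + s) :
    I.cost ω T (epochs I.ell T k j Js) s ≤ ∑ i ∈ Finset.range k, epochBound n T d ε (j + i) +
        (8 * ε + 3 / (T : ℕ)) * ((T : ℕ) - (min s T : ℕ) : ℝ) ∧
      ((T : ℕ) ≤ (I.run ω (epochs I.ell T k j Js) s).2 ∨
        2 ^ (j + k) ≤ 2 + (I.run ω (epochs I.ell T k j Js) s).2) := by
  have hnn (s : ℕ) : 0 ≤ (8 * ε + 3 / (T : ℕ)) * ((T : ℕ) - (min s T : ℕ) : ℝ) := by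
    apply mul_nonneg (by positivity)
    have : ((min s T : ℕ) : ℝ) ≤ (T : ℕ) := by exact_mod_cast min_le_right _ _
    linarith
  have hsum (k j : ℕ) : 0 ≤ ∑ i ∈ Finset.range k, epochBound n T d ε (j + i) :=
    Finset.sum_nonneg fun i _ => epochBound_nonneg _ _ _ _ _
  induction k generalizing j Js s with
  | zero => exact ⟨by simpa [epochs] using hnn s, Or.inr (by simpa [epochs] using hs)⟩
  | succ k ih =>
    rcases le_or_gt (T : ℕ) s with hTs | hTs
    · refine ⟨?_, Or.inl (hTs.trans (I.le_run_snd ω _ _))⟩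
      rw [I.cost_eq_zero ω _ hTs]
      exact add_nonneg (hsum _ _) (hnn _)
    have hjd : j < d := by
      rw [← Nat.pow_lt_pow_iff_right (a := 2) (by norm_num)]
      omega
    have hΔ : (0 : ℝ) < 1 / 2 ^ j := by positivity
    have h1 := cost_findAllJumps_le hjd (by omega) hε (hacc j hj hjd) hJs hjumps hlen s
    have hne : Js ≠ [] := by
      rintro rfl
      obtain ⟨J, hJ, -⟩ := hJs.cover
      simp at hJ
    have h2 := I.add_numSamples_le_run_findAllJumps ω T (1 / 2 ^ j) hne s
    have h3 := two_pow_le_numSamples T j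
    rw [epochs]
    simp only [run_bind, cost_bind]
    set e := (I.run ω (findAllJumps T (1 / 2 ^ j) Js) s).2 with he
    set l := (I.run ω (findAllJumps T (1 / 2 ^ j) Js) s).1 with hl
    rw [Finset.sum_range_succ']
    simp only [add_zero, ← add_assoc]
    rcases le_or_gt (T : ℕ) e with hTe | hTe
    -- The horizon falls into this epoch: its outcome may rest on inaccurate estimates, but later
    -- epochs cost nothing.
    · refine ⟨?_, Or.inl (hTe.trans (I.le_run_snd ω _ _))⟩
      rw [I.cost_eq_zero ω _ hTe, add_zero]
      rw [min_eq_right hTe] at h1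
      have := hsum k (j + 1)
      simp only [add_assoc, add_comm 1] at this ⊢
      linarith
    · obtain ⟨l1, l2, l3, l4⟩ := run_findAllJumps_spec ω (hacc j hj hjd) hΔ
        (show (T : ℕ) ≤ 2 ^ d by omega) hJs.valid s hTe
      have hcov : ∃ τ ∈ l, α ∈ Icc τ.α₁ τ.α₂ := by
        obtain ⟨J, hJ, hαJ⟩ := hJs.cover
        exact l4 J hJ α hαJ
      have hsound := sound_flatMap l1 hΔ hα hcov
      have hlen' := (length_flatMap_optimisticShrink_le (I := I) (T := T) (Δ := 1 / 2 ^ j)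
        (optEstimate I.ell l) l).trans l2
      have hjumps' := ((totalJumps_flatMap_optimisticShrink_le (optEstimate I.ell l) l1).trans
        l3).trans hjumps
      have hhalf : 4 * (1 / 2 ^ j : ℝ) = 8 * (1 / 2 ^ (j + 1)) := by
        rw [pow_succ]
        field_simp
        norm_num
      rw [hhalf] at hsound
      obtain ⟨h4, h5⟩ := ih (j := j + 1) (by omega) hsound hjumps' (s := e)
        (hlen'.trans (by nlinarith [Nat.mul_le_mul_left d hjumps])) (by rw [pow_succ]; omega)
      constructor
      · rw [min_eq_left hTe.le] at h1 h4
        simp only [add_assoc, add_comm 1] at h4 ⊢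
        linarith
      · rw [show j + k + 1 = j + 1 + k by omega]
        exact h5

theorem sum_regret_le {ω : ℕ × Fin n → ℝ} {d : ℕ} (hTd : (T : ℕ) + 1 < 2 ^ d) {ε : ℝ}
    (hε : 0 ≤ ε)
    (hacc : ∀ j, 1 ≤ j → j < d →
      I.AccurateSamples ω T (numSamples T (1 / 2 ^ j)) (1 / 2 ^ j)) :
    ∑ t ∈ Finset.range T, (I.OPT - I.u (I.action (rjiOS I.ell T) ω t)) ≤
      ∑ i ∈ Finset.range T, epochBound n T d ε (1 + i) + (8 * ε + 3 / (T : ℕ)) * (T : ℕ) := by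
  obtain ⟨α, hα, hαu⟩ := I.exists_u_eq_OPT
  have hd : 1 ≤ d := by
    rcases Nat.eq_zero_or_pos d with rfl | h
    · have := T.pos
      simp at hTd
    · exact h
  have hn : 1 ≤ n := NeZero.one_le
  have hT : (0 : ℝ) ≤ 3 / (T : ℕ) := by positivity
  -- The first epoch has `Δ = 1 / 2`, so its level is at least `4` and the gap condition is trivial.
  have hgap (x : ℝ) (hx : x ∈ Icc (0 : ℝ) 1) :
      I.OPT - I.u x ≤ 8 * (1 / 2 ^ 1) + 3 / (T : ℕ) := by
    have := (I.u_mem hx).1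
    have := I.OPT_mem.2
    linarith
  have hsound : I.Sound T (8 * (1 / 2 ^ 1) + 3 / (T : ℕ)) α [(0, 1)] :=
    ⟨by simp, fun J hJ => by
      rw [List.mem_singleton] at hJ
      subst hJ
      exact ⟨hgap 1 (by simp), fun _ => hgap⟩, ⟨(0, 1), by simp, hα⟩⟩
  obtain ⟨h1, h2⟩ := cost_epochs_le hTd hε hacc hαu T le_rfl hsound
    (by simpa [totalJumps] using I.numJumps_le_card 0 1)
    (by simpa using Nat.mul_le_mul hd hn) (s := 0) (by norm_num)
  have hend : (T : ℕ) ≤ (I.run ω (epochs I.ell T T 1 [(0, 1)]) 0).2 := by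
    rcases h2 with h2 | h2
    · exact h2
    · have := Nat.lt_two_pow_self (n := (T : ℕ))
      have := T.pos
      rw [pow_add] at h2
      omega
  have h3 := I.sum_act_eq_cost ω _ hend
  simp only [rjiOS, action_toPolicy]
  rw [Nat.sub_zero] at h3
  rw [h3]
  simpa using h1

end Instance

namespace Instance

variable {n : ℕ} (I : Instance n)

/-! ### The estimates are accurate with high probability -/

theorem hasSubgaussianMGF_sample (p : ℕ × Fin n) :
    HasSubgaussianMGF (fun ω : ℕ × Fin n → ℝ => ω p - I.mean p.2) (1 / 4) I.envMeasure := by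
  have hmp : MeasurePreserving (fun ω : ℕ × Fin n → ℝ => ω p) I.envMeasure (I.ν p.2) :=
    measurePreserving_eval_infinitePi _ p
  have : IsProbabilityMeasure I.envMeasure := by unfold envMeasure; infer_instance
  have hmean : ∫ ω, ω p ∂I.envMeasure = I.mean p.2 := by
    unfold mean
    rw [← hmp.map_eq, integral_map hmp.aemeasurable (by fun_prop)]
  -- Hoeffding's lemma: the parameter is the square of half the length of `[0,1]`.
  have h := hasSubgaussianMGF_of_mem_Icc (a := 0) (b := 1) hmp.aemeasurable
    (hmp.quasiMeasurePreserving.ae (I.ν_supp p.2))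
  rw [hmean] at h
  convert h using 1
  ext
  norm_num

theorem measureReal_avg_sub_mean_le (N s : ℕ) (hN : 0 < N) (i : Fin n) {ε : ℝ} (hε : 0 ≤ ε) :
    I.envMeasure.real {ω | ε < |avg ω N s i - I.mean i|} ≤
      2 * Real.exp (-(2 * N * ε ^ 2)) := by
  have hNpos : (0 : ℝ) < N := by exact_mod_cast hN
  have : IsProbabilityMeasure I.envMeasure := by unfold envMeasure; infer_instance
  have hinj : Function.Injective fun t : ℕ => (s + t, i) := fun a b h => by
    simpa using h
  have hexp : -(N * ε) ^ 2 / (2 * N * ((1 / 4 : NNReal) : ℝ)) = -(2 * N * ε ^ 2) := by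
    push_cast
    field_simp
    norm_num
  have hup := HasSubgaussianMGF.measure_sum_range_ge_le_of_iIndepFun
    (μ := I.envMeasure) (X := fun t ω => ω (s + t, i) - I.mean i) (c := 1 / 4) (n := N)
    (iIndepFun.precomp hinj (iIndepFun_infinitePi (P := fun p : ℕ × Fin n => I.ν p.2)
      (X := fun p x => x - I.mean p.2) fun p => by fun_prop))
    (fun t _ => I.hasSubgaussianMGF_sample (s + t, i)) (ε := N * ε) (by positivity)
  have hlo := HasSubgaussianMGF.measure_sum_range_ge_le_of_iIndepFun
    (μ := I.envMeasure) (X := fun t ω => -(ω (s + t, i) - I.mean i)) (c := 1 / 4) (n := N)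
    (iIndepFun.precomp hinj (iIndepFun_infinitePi (P := fun p : ℕ × Fin n => I.ν p.2)
      (X := fun p x => -(x - I.mean p.2)) fun p => by fun_prop))
    (fun t _ => (I.hasSubgaussianMGF_sample (s + t, i)).neg) (ε := N * ε) (by positivity)
  rw [hexp] at hup hlo
  refine (measureReal_mono ?_).trans ((measureReal_union_le _ _).trans
    ((add_le_add hup hlo).trans (two_mul _).ge))
  intro ω hω
  have hω' : ε < |avg ω N s i - I.mean i| := hω
  have hsum : ∑ t ∈ Finset.range N, (ω (s + t, i) - I.mean i) =
      N * (avg ω N s i - I.mean i) := by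
    rw [Finset.sum_sub_distrib, avg]
    simp
    field_simp
  rcases lt_abs.1 hω' with h | h
  · left
    change N * ε ≤ ∑ t ∈ Finset.range N, (ω (s + t, i) - I.mean i)
    rw [hsum]
    exact mul_le_mul_of_nonneg_left h.le hNpos.le
  · right
    change N * ε ≤ ∑ t ∈ Finset.range N, -(ω (s + t, i) - I.mean i)
    rw [Finset.sum_neg_distrib, hsum, ← mul_neg]
    exact mul_le_mul_of_nonneg_left h.le hNpos.le

/-- The event that some estimate of the first epochs is not accurate. -/
def badEvent (T : ℕ+) (d : ℕ) : Set (ℕ × Fin n → ℝ) :=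
  ⋃ q ∈ Finset.range T ×ˢ (Finset.univ : Finset (Fin n)) ×ˢ Finset.range d,
    {ω | (1 / 2 ^ q.2.2 : ℝ) / 4 <
      |avg ω (numSamples T (1 / 2 ^ q.2.2)) q.1 q.2.1 - I.mean q.2.1|}

theorem measurableSet_badEvent (T : ℕ+) (d : ℕ) : MeasurableSet (I.badEvent T d) := by
  refine Finset.measurableSet_biUnion _ fun q _ => ?_
  refine measurableSet_lt measurable_const ?_
  unfold avg
  fun_prop

theorem accurateSamples_of_notMem_badEvent {T : ℕ+} {d : ℕ} {ω : ℕ × Fin n → ℝ}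
    (h : ω ∉ I.badEvent T d) [NeZero n] {j : ℕ} (hj : j < d) :
    I.AccurateSamples ω T (numSamples T (1 / 2 ^ j)) (1 / 2 ^ j) := by
  intro s hs i
  by_contra! hlt
  refine h (mem_biUnion (x := (s, i, j)) ?_ hlt)
  simp [hs, hj]

theorem measureReal_badEvent_le (T : ℕ+) (d : ℕ) :
    I.envMeasure.real (I.badEvent T d) ≤ n * d / (2 * (T : ℕ)) := by
  have hT : (0 : ℝ) < (T : ℕ) := by exact_mod_cast T.pos
  have : IsProbabilityMeasure I.envMeasure := by unfold envMeasure; infer_instance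
  calc I.envMeasure.real (I.badEvent T d)
      ≤ ∑ q ∈ Finset.range T ×ˢ (Finset.univ : Finset (Fin n)) ×ˢ Finset.range d,
          1 / (2 * ((T : ℕ) : ℝ) ^ 2) := by
        refine (measureReal_biUnion_finset_le _ _).trans (Finset.sum_le_sum fun q _ => ?_)
        have hN := two_pow_le_numSamples T q.2.2
        have hN' := le_numSamples T q.2.2
        refine (I.measureReal_avg_sub_mean_le _ q.1 (lt_of_lt_of_le (by positivity) hN) q.2.1
          (by positivity)).trans ?_
        have h4 : (4 : ℝ) ^ q.2.2 = (2 ^ q.2.2) ^ 2 := by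
          rw [← pow_mul, mul_comm, pow_mul]
          norm_num
        -- As `N ≥ 8 log(4 T²) / Δ²`, the exponent `2 N (Δ/4)² = N Δ² / 8` is at least `log(4 T²)`;
        -- the two tails together have probability at most `2 / (4 T²)`.
        have h5 : Real.log (4 * ((T : ℕ) : ℝ) ^ 2) ≤
            2 * numSamples T (1 / 2 ^ q.2.2) * ((1 / 2 ^ q.2.2 : ℝ) / 4) ^ 2 := by
          rw [h4] at hN'
          have h6 := mul_le_mul_of_nonneg_right hN'
            (show (0 : ℝ) ≤ 2 * ((1 / 2 ^ q.2.2 : ℝ) / 4) ^ 2 by positivity)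
          refine le_trans (le_of_eq ?_) (h6.trans (le_of_eq (by ring)))
          field_simp
          ring
        have h7 : Real.exp (-(2 * numSamples T (1 / 2 ^ q.2.2) *
            ((1 / 2 ^ q.2.2 : ℝ) / 4) ^ 2)) ≤ 1 / (4 * ((T : ℕ) : ℝ) ^ 2) := by
          refine (Real.exp_le_exp.2 (neg_le_neg h5)).trans ?_
          rw [Real.exp_neg, Real.exp_log (by positivity), one_div]
        refine (mul_le_mul_of_nonneg_left h7 zero_le_two).trans (le_of_eq ?_)
        field_simp
        norm_num
    _ = n * d / (2 * (T : ℕ)) := by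
        simp only [Finset.sum_const, Finset.card_product, Finset.card_range, Finset.card_univ,
          Fintype.card_fin, nsmul_eq_mul]
        push_cast
        field_simp

/-! ### The bound for the pseudo-regret -/

variable [NeZero n]

/-- This is where measurability of the actions is used: the integral of a non-integrable function is
`0` by convention, which would make the regret meaningless. -/
theorem integrable_sum_u (T : ℕ+) :
    Integrable (fun ω => ∑ t ∈ Finset.range T, I.u (I.action (rjiOS I.ell T) ω t))
      I.envMeasure := by
  have : IsProbabilityMeasure I.envMeasure := by unfold envMeasure; infer_instance
  refine integrable_finsetSum _ fun t _ => Integrable.of_mem_Icc 0 1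
    (I.measurable_u.comp (I.measurable_action_rjiOS T t)).aemeasurable ?_
  exact Filter.Eventually.of_forall fun ω => I.u_mem (I.action_rjiOS_mem T ω t)

theorem sum_regret_le_horizon (T : ℕ+) (ω : ℕ × Fin n → ℝ) :
    ∑ t ∈ Finset.range T, (I.OPT - I.u (I.action (rjiOS I.ell T) ω t)) ≤ (T : ℕ) := by
  calc ∑ t ∈ Finset.range T, (I.OPT - I.u (I.action (rjiOS I.ell T) ω t))
      ≤ ∑ _t ∈ Finset.range (T : ℕ), (1 : ℝ) := Finset.sum_le_sum fun t _ => by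
        linarith [I.OPT_mem.2, (I.u_mem (I.action_rjiOS_mem T ω t)).1]
    _ = (T : ℕ) := by simp

/-- A bound for the regret outside of the bad event yields a bound for the pseudo-regret. -/
theorem regret_rjiOS_le (T : ℕ+) {A : Set (ℕ × Fin n → ℝ)} (hA : MeasurableSet A) {B : ℝ}
    (hB : 0 ≤ B)
    (h : ∀ ω ∉ A, ∑ t ∈ Finset.range T, (I.OPT - I.u (I.action (rjiOS I.ell T) ω t)) ≤ B) :
    I.regret T (rjiOS I.ell T) ≤ B + (T : ℕ) * I.envMeasure.real A := by
  have : IsProbabilityMeasure I.envMeasure := by unfold envMeasure; infer_instance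
  have hT : (0 : ℝ) ≤ (T : ℕ) := by positivity
  have hint := I.integrable_sum_u T
  have heq (ω : ℕ × Fin n → ℝ) : (T : ℕ) * I.OPT -
      ∑ t ∈ Finset.range T, I.u (I.action (rjiOS I.ell T) ω t) =
      ∑ t ∈ Finset.range T, (I.OPT - I.u (I.action (rjiOS I.ell T) ω t)) := by
    rw [Finset.sum_sub_distrib]
    simp
  have hreg : I.regret T (rjiOS I.ell T) = ∫ ω, ((T : ℕ) * I.OPT -
      ∑ t ∈ Finset.range T, I.u (I.action (rjiOS I.ell T) ω t)) ∂I.envMeasure := by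
    rw [integral_sub (integrable_const _) hint]
    simp [regret]
  have hind : Integrable (A.indicator fun _ => ((T : ℕ) : ℝ)) I.envMeasure :=
    (integrable_const _).indicator hA
  calc I.regret T (rjiOS I.ell T)
      ≤ ∫ ω, (B + A.indicator (fun _ => ((T : ℕ) : ℝ)) ω) ∂I.envMeasure := by
        rw [hreg]
        refine integral_mono ((integrable_const _).sub hint) ((integrable_const _).add hind)
          fun ω => ?_
        dsimp only
        rw [heq]
        by_cases hω : ω ∈ A
        · rw [indicator_of_mem hω]
          linarith [I.sum_regret_le_horizon T ω]
        · rw [indicator_of_notMem hω]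
          linarith [h ω hω]
    _ = B + (T : ℕ) * I.envMeasure.real A := by
        rw [integral_add (integrable_const _) hind, integral_indicator_const _ hA]
        simp [mul_comm]

end Instance

/-! ### Summation over the epochs and logarithmic estimates -/

theorem sum_two_pow_lt_le {x : ℝ} (hx : 0 ≤ x) (k : ℕ) :
    (∑ i ∈ Finset.range k, if (2 : ℝ) ^ (1 + i) < x then (2 : ℝ) ^ (1 + i) else 0) ≤ 2 * x := by
  -- The second bound carries the induction: when the next power is below `x`, the earlier terms sum
  -- to at most that power.
  suffices (∑ i ∈ Finset.range k, if (2 : ℝ) ^ (1 + i) < x then (2 : ℝ) ^ (1 + i) else 0) ≤ 2 * x ∧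
      (∑ i ∈ Finset.range k, if (2 : ℝ) ^ (1 + i) < x then (2 : ℝ) ^ (1 + i) else 0) ≤ 2 ^ (1 + k)
    from this.1
  induction k with
  | zero => simpa using hx
  | succ k ih =>
    rw [Finset.sum_range_succ, show 1 + (k + 1) = (1 + k) + 1 by omega, pow_succ]
    have hp : (0 : ℝ) < 2 ^ (1 + k) := by positivity
    split_ifs with h
    · constructor <;> linarith [ih.2]
    · constructor <;> linarith [ih.1, ih.2]

theorem sum_epochBound_le (n : ℕ) {T : ℕ+} (hT : 2 ≤ (T : ℕ)) (d : ℕ) {ε : ℝ} (hε : 0 < ε)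
    (k : ℕ) :
    ∑ i ∈ Finset.range k, Instance.epochBound n T d ε (1 + i) ≤
      3264 * d ^ 2 * n * Real.log (T : ℕ) / ε := by
  have hL : 0 ≤ Real.log (T : ℕ) := Real.log_natCast_nonneg _
  calc ∑ i ∈ Finset.range k, Instance.epochBound n T d ε (1 + i)
      ≤ ∑ i ∈ Finset.range k, 1632 * d ^ 2 * n * Real.log (T : ℕ) *
          (if (2 : ℝ) ^ (1 + i) < 1 / ε then (2 : ℝ) ^ (1 + i) else 0) := by
        refine Finset.sum_le_sum fun i _ => ?_
        unfold Instance.epochBound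
        have hp : (0 : ℝ) < 2 ^ (1 + i) := by positivity
        simp only [lt_one_div hε hp]
        split_ifs with h
        · have h1 := Instance.numSamples_le hT (1 + i)
          have h4 : (4 : ℝ) ^ (1 + i) = 2 ^ (1 + i) * 2 ^ (1 + i) := by
            rw [← mul_pow]
            norm_num
          rw [h4] at h1
          calc 48 * (d : ℝ) ^ 2 * n * numSamples T (1 / 2 ^ (1 + i)) * (1 / 2 ^ (1 + i))
              ≤ 48 * (d : ℝ) ^ 2 * n * (34 * (2 ^ (1 + i) * 2 ^ (1 + i)) * Real.log (T : ℕ)) *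
                (1 / 2 ^ (1 + i)) := by gcongr
            _ = _ := by
              field_simp
              ring
        · simp
    _ ≤ 1632 * d ^ 2 * n * Real.log (T : ℕ) * (2 * (1 / ε)) := by
        rw [← Finset.mul_sum]
        exact mul_le_mul_of_nonneg_left (sum_two_pow_lt_le (by positivity) k) (by positivity)
    _ = _ := by ring

/-- For `T ≥ 2`, `T + 1 ≤ T ^ 2` gives `log₂ (T + 1) ≤ 2 log T / log 2 < 3 log T`, and `1 < 2 log
T`. -/
theorem natLog_succ_add_one_le {T : ℕ} (hT : 2 ≤ T) :
    ((Nat.log 2 (T + 1) + 1 : ℕ) : ℝ) ≤ 5 * Real.log T := by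
  have hT' : (2 : ℝ) ≤ T := by exact_mod_cast hT
  have hlog : Real.log 2 ≤ Real.log T := Real.log_le_log (by norm_num) hT'
  have hl2 := Real.log_two_gt_d9
  have h1 : 2 ^ Nat.log 2 (T + 1) ≤ T + 1 := Nat.pow_log_le_self 2 (by omega)
  have h2 : (2 : ℝ) ^ Nat.log 2 (T + 1) ≤ T ^ 2 := by
    have : (2 : ℝ) ^ Nat.log 2 (T + 1) ≤ T + 1 := by exact_mod_cast h1
    nlinarith
  have h3 := Real.log_le_log (by positivity) h2
  rw [Real.log_pow, Real.log_pow] at h3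
  push_cast at h3 ⊢
  have h4 : (0 : ℝ) ≤ Nat.log 2 (T + 1) := by positivity
  nlinarith

end BwMJ

end

/-! ### Choice of the threshold and conclusion -/

theorem mainTheorem1 :
    ∃ C : ℝ, 0 < C ∧ ∀ (n : ℕ) [NeZero n] (I : BwMJ.Instance n) (T : ℕ+), 2 ≤ (T : ℕ) →
      I.regret T (BwMJ.rjiOS I.ell T) ≤
        C * (Real.sqrt ((n : ℝ) * (T : ℕ)) * Real.log (T : ℕ) ^ 2) := by
  refine ⟨100000, by norm_num, fun n _ I T hT => ?_⟩
  have hT' : (2 : ℝ) ≤ (T : ℕ) := by exact_mod_cast hT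
  have hn : (1 : ℝ) ≤ n := by exact_mod_cast NeZero.one_le (n := n)
  have hL : 1 / 2 ≤ Real.log (T : ℕ) := by
    have h1 : Real.log 2 ≤ Real.log (T : ℕ) := Real.log_le_log (by norm_num) hT'
    have h2 := Real.log_two_gt_d9
    linarith
  have hd := BwMJ.natLog_succ_add_one_le hT
  set L := Real.log (T : ℕ)
  set d := Nat.log 2 ((T : ℕ) + 1) + 1
  set S := Real.sqrt ((n : ℝ) * (T : ℕ)) with hS
  have hS2 : S ^ 2 = n * (T : ℕ) := Real.sq_sqrt (by positivity)
  have hSpos : 0 < S := Real.sqrt_pos.2 (by positivity)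
  rcases le_or_gt ((T : ℕ) : ℝ) n with hnT | hnT
  -- For `n ≥ T` the trivial bound `T ≤ √(nT)` suffices, since `log² T ≥ 1/4`.
  · have h1 := I.regret_rjiOS_le T MeasurableSet.empty (B := (T : ℕ)) (by positivity)
      fun ω _ => I.sum_regret_le_horizon T ω
    simp only [MeasureTheory.measureReal_empty, mul_zero, add_zero] at h1
    have h2 : ((T : ℕ) : ℝ) ≤ S := Real.le_sqrt_of_sq_le (by nlinarith)
    have h3 : S * (1 / 2) ^ 2 ≤ S * L ^ 2 := by gcongr
    nlinarith
  -- This threshold cancels the factor `log T` from the number of samples: the large epochs cost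
  -- `O(d² S)` and the other rounds `8 L S + 3`.
  · have hε : 0 < L * S / (T : ℕ) := by positivity
    have hTd : (T : ℕ) + 1 < 2 ^ d := Nat.lt_pow_succ_log_self (by norm_num) _
    have hsum := BwMJ.sum_epochBound_le n hT d hε T
    have hB0 : (0 : ℝ) ≤
        ∑ i ∈ Finset.range T, BwMJ.Instance.epochBound n T d (L * S / (T : ℕ)) (1 + i) :=
      Finset.sum_nonneg fun i _ => BwMJ.Instance.epochBound_nonneg _ _ _ _ _
    have h1 := I.regret_rjiOS_le T (I.measurableSet_badEvent T d) (add_nonneg hB0 (by positivity))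
      fun ω hω => BwMJ.Instance.sum_regret_le hTd hε.le fun j _ hj =>
        I.accurateSamples_of_notMem_badEvent hω hj
    have h2 := mul_le_mul_of_nonneg_left (I.measureReal_badEvent_le T d)
      (show (0 : ℝ) ≤ (T : ℕ) by positivity)
    have h3 : (T : ℕ) * (n * d / (2 * (T : ℕ)) : ℝ) = n * d / 2 := by field_simp
    have h4 : (8 * (L * S / (T : ℕ)) + 3 / (T : ℕ)) * (T : ℕ) = 8 * (L * S) + 3 := by field_simp
    have h5 : 3264 * (d : ℝ) ^ 2 * n * L / (L * S / (T : ℕ)) = 3264 * d ^ 2 * S := by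
      have : 3264 * (d : ℝ) ^ 2 * n * L / (L * S / (T : ℕ)) = 3264 * d ^ 2 * (n * (T : ℕ)) / S := by
        field_simp
      rw [this, ← hS2]
      field_simp
    -- Here `n < T` is needed: it makes the contribution `n d / 2` of the bad event a lower-order
    -- term.
    have h6 : (n : ℝ) ≤ S := Real.le_sqrt_of_sq_le (by nlinarith)
    have h7 : 3264 * (d : ℝ) ^ 2 * S ≤ 3264 * (5 * L) ^ 2 * S := by gcongr
    have h8 : (n : ℝ) * d ≤ S * (5 * L) := by gcongr
    have h9 : S * L ≤ 2 * (S * L ^ 2) := by nlinarith [mul_pos hSpos (show 0 < L by linarith)]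
    have h10 : S ≤ 2 * (S * L) := by nlinarith
    rw [h3] at h2
    rw [h4] at h1
    rw [h5] at hsum
    have h11 : 3264 * (5 * L) ^ 2 * S = 81600 * (S * L ^ 2) := by ring
    have h12 : L * S = S * L := mul_comm _ _
    have h13 : (1 : ℝ) ≤ S := hn.trans h6
    rw [h11] at h7
    -- In units of `S L²` the terms are at most `81600`, `16` (from `8 L S`), `12` (from `3`) and
    -- `5` (from `n d / 2`).
    linarith
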